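/- Let $(\bar M,g,H)$ be a compact locally conformal quaternion Kaehler manifold. That is, $H\subset \mathrm{End}(T\bar M)$ is locally spanned by almost complex structures $J_1,J_2,J_3=J_1J_2$ satisfying the quaternion relations and isometric for $g$; $\bar M$ is covered by open sets $U$ carrying smooth functions $f$ such that $g=e^{f}g'$ on $U$, where $g'$ is a metric on $U$ whose Levi-Civita connection preserves $H$ (a quaternion Kaehler metric); and the Lee form $\omega$ is the $1$-form on $\bar M$ with $\omega=df$ on each such $U$. Let $\bar\nabla$ be the Levi-Civita connection of $g$ and $B$ the Lee vector field, $\omega(X)=g(X,B)$, and suppose that $g$ is chosen so that $\bar\nabla\omega=0$ and $\|\omega\|=1$. Let $M$ be a nonempty totally umbilical quaternion CR-submanifold of $\bar M$. Here quaternion CR means that $TM=D\oplus D^\perp$ for two orthogonal smooth distributions such that $JD\subseteq D$ and $JD^\perp\subseteq TM^\perp$ for all $J\in H$; totally umbilical means that the second fundamental form is $h(X,Y)=g(X,Y)\,\eta$ for a field $\eta$ normal to $M$ (the mean curvature vector). Suppose that $B$ is tangent to $M$ at every point of $M$. 1. The sectional curvature of $\bar M$ satisfies $K_{\bar M}(X,Y)\le\frac14$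 for all orthonormal $X\in D_p$, $Y\in D^\perp_p$, $p\in M$. 2. If $M$ is proper, that is, $D\ne0$ and $D^\perp\neq 0$, then equality $K_{\bar M}(X,Y)=\frac14$ holds for all orthonormal $X\in D_p$, $Y\in D_p^\perp$ and all $p\in M$ if and only if $g$ is a quaternion Kaehler metric on $\bar M$ (that is, $\bar\nabla H\subset H$), and the latter holds if and only if $B=0$. (Since $\|\omega\|=1$ excludes $B=0$, this says that equality never holds for all such pairs.) -/

import Mathlib

open Bundle Set Filter
open scoped Manifold ContDiff Topology

noncomputable section

namespace QCR

section Ambient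

variable {E : Type*} [NormedAddCommGroup E] [NormedSpace ℝ E]
  {N : Type*} [TopologicalSpace N] [ChartedSpace E N] [IsManifold 𝓘(ℝ, E) ∞ N]

/-- `nabla` is the Levi-Civita connection, over the set `U`, of the family of scalar products `g`:
a connection on the tangent bundle that maps smooth fields to smooth fields, is torsion-free and
makes `g` parallel. The value of `nabla Y` at `x` on the tangent vector `v` is `∇_v Y`. -/
structure IsLeviCivitaOn
    (g : Π x : N, TangentSpace 𝓘(ℝ, E) x →L[ℝ] TangentSpace 𝓘(ℝ, E) x →L[ℝ] ℝ)
    (nabla : (Π x : N, TangentSpace 𝓘(ℝ, E) x) →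
      (Π x : N, TangentSpace 𝓘(ℝ, E) x →L[ℝ] TangentSpace 𝓘(ℝ, E) x))
    (U : Set N) : Prop where
  isCovariantDerivativeOn : IsCovariantDerivativeOn E nabla U
  smooth : ∀ (X Y : Π x : N, TangentSpace 𝓘(ℝ, E) x), ∀ x ∈ U,
    CMDiffAt ∞ (T% X) x → CMDiffAt ∞ (T% Y) x → CMDiffAt ∞ (T% (fun y ↦ nabla Y y (X y))) x
  torsion_free : ∀ (X Y : Π x : N, TangentSpace 𝓘(ℝ, E) x), ∀ x ∈ U,
    MDiffAt (T% X) x → MDiffAt (T% Y) x →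
      nabla Y x (X x) - nabla X x (Y x) = VectorField.mlieBracket 𝓘(ℝ, E) X Y x
  metric : ∀ (Y Z : Π x : N, TangentSpace 𝓘(ℝ, E) x), ∀ x ∈ U,
    MDiffAt (T% Y) x → MDiffAt (T% Z) x → ∀ v : TangentSpace 𝓘(ℝ, E) x,
      d% (fun y ↦ g y (Y y) (Z y)) x v = g x (nabla Y x v) (Z x) + g x (Y x) (nabla Z x v)

/-- The curvature `R(X,Y)Z = ∇_X ∇_Y Z - ∇_Y ∇_X Z - ∇_[X,Y] Z` of a connection. -/
def curvature (nabla : (Π x : N, TangentSpace 𝓘(ℝ, E) x) →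
      (Π x : N, TangentSpace 𝓘(ℝ, E) x →L[ℝ] TangentSpace 𝓘(ℝ, E) x))
    (X Y Z : Π x : N, TangentSpace 𝓘(ℝ, E) x) (x : N) : TangentSpace 𝓘(ℝ, E) x :=
  nabla (fun y ↦ nabla Z y (Y y)) x (X x) - nabla (fun y ↦ nabla Z y (X y)) x (Y x)
    - nabla Z x (VectorField.mlieBracket 𝓘(ℝ, E) X Y x)

/-- The sectional curvature `K(u,v) = g(R(u,v)v,u) / (g(u,u) g(v,v) - g(u,v)^2)` of the plane
spanned by two tangent vectors at `x`. The curvature being tensorial, it is evaluated on local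
smooth extensions of `u` and `v`. -/
def sectionalCurvature
    (g : Π x : N, TangentSpace 𝓘(ℝ, E) x →L[ℝ] TangentSpace 𝓘(ℝ, E) x →L[ℝ] ℝ)
    (nabla : (Π x : N, TangentSpace 𝓘(ℝ, E) x) →
      (Π x : N, TangentSpace 𝓘(ℝ, E) x →L[ℝ] TangentSpace 𝓘(ℝ, E) x))
    (x : N) (u v : TangentSpace 𝓘(ℝ, E) x) : ℝ :=
  g x (curvature nabla (FiberBundle.extend E u) (FiberBundle.extend E v)
      (FiberBundle.extend E v) x) u / (g x u u * g x v v - g x u v ^ 2)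

/-- `H` is a quaternion Hermitian structure for `g` over `U`: a subbundle of `End(TN)` which is
locally spanned by three smooth almost complex structures `J 0`, `J 1`, `J 2 = J 0 ∘ J 1` that
satisfy the quaternion relations and are isometries of `g`.
(The relation `J 1 ∘ J 0 = - J 2` follows from the ones listed.) -/
def IsQuaternionHermitianOn
    (g : Π x : N, TangentSpace 𝓘(ℝ, E) x →L[ℝ] TangentSpace 𝓘(ℝ, E) x →L[ℝ] ℝ)
    (H : Π x : N, Submodule ℝ (TangentSpace 𝓘(ℝ, E) x →L[ℝ] TangentSpace 𝓘(ℝ, E) x))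
    (U : Set N) : Prop :=
  ∀ x ∈ U, ∃ V : Set N, IsOpen V ∧ x ∈ V ∧
    ∃ J : Fin 3 → Π y : N, TangentSpace 𝓘(ℝ, E) y →L[ℝ] TangentSpace 𝓘(ℝ, E) y,
      (∀ a, ContMDiffOn 𝓘(ℝ, E) (𝓘(ℝ, E).prod 𝓘(ℝ, E →L[ℝ] E)) ∞
        (fun y ↦ TotalSpace.mk' (E →L[ℝ] E)
          (E := fun y : N ↦ TangentSpace 𝓘(ℝ, E) y →L[ℝ] TangentSpace 𝓘(ℝ, E) y) y (J a y)) V) ∧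
      ∀ y ∈ V,
        (∀ a v, J a y (J a y v) = -v) ∧
        (∀ v, J 0 y (J 1 y v) = J 2 y v) ∧
        (∀ a v w, g y (J a y v) (J a y w) = g y v w) ∧
        H y = Submodule.span ℝ (Set.range fun a ↦ J a y)

/-- The connection `nabla` preserves the bundle of endomorphisms `H` over `U`: for every smooth
local section `J` of `H` and every `v`, the endomorphism
`∇_v J : Y ↦ ∇_v (J Y) - J (∇_v Y)` lies in `H`. -/
def PreservesOn
    (nabla : (Π x : N, TangentSpace 𝓘(ℝ, E) x) →
      (Π x : N, TangentSpace 𝓘(ℝ, E) x →L[ℝ] TangentSpace 𝓘(ℝ, E) x))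
    (H : Π x : N, Submodule ℝ (TangentSpace 𝓘(ℝ, E) x →L[ℝ] TangentSpace 𝓘(ℝ, E) x))
    (U : Set N) : Prop :=
  ∀ x ∈ U, ∀ J : Π y : N, TangentSpace 𝓘(ℝ, E) y →L[ℝ] TangentSpace 𝓘(ℝ, E) y,
    ContMDiffAt 𝓘(ℝ, E) (𝓘(ℝ, E).prod 𝓘(ℝ, E →L[ℝ] E)) ∞
      (fun y ↦ TotalSpace.mk' (E →L[ℝ] E)
        (E := fun y : N ↦ TangentSpace 𝓘(ℝ, E) y →L[ℝ] TangentSpace 𝓘(ℝ, E) y) y (J y)) x →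
    (∀ᶠ y in 𝓝 x, J y ∈ H y) →
    ∀ v : TangentSpace 𝓘(ℝ, E) x, ∃ K ∈ H x, ∀ Y : Π y : N, TangentSpace 𝓘(ℝ, E) y,
      MDiffAt (T% Y) x → nabla (fun y ↦ J y (Y y)) x v - J x (nabla Y x v) = K (Y x)

/-- `g` is a quaternion Kaehler metric over `U` with respect to `H`: it is quaternion Hermitian and
its Levi-Civita connection preserves `H`. -/
def IsQuaternionKaehlerOn
    (g : Π x : N, TangentSpace 𝓘(ℝ, E) x →L[ℝ] TangentSpace 𝓘(ℝ, E) x →L[ℝ] ℝ)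
    (H : Π x : N, Submodule ℝ (TangentSpace 𝓘(ℝ, E) x →L[ℝ] TangentSpace 𝓘(ℝ, E) x))
    (U : Set N) : Prop :=
  IsQuaternionHermitianOn g H U ∧
    ∃ nabla : (Π x : N, TangentSpace 𝓘(ℝ, E) x) →
        (Π x : N, TangentSpace 𝓘(ℝ, E) x →L[ℝ] TangentSpace 𝓘(ℝ, E) x),
      IsLeviCivitaOn g nabla U ∧ PreservesOn nabla H U

/-- `(N, g, H)` is a locally conformal quaternion Kaehler manifold with Lee form `θ`: it is
quaternion Hermitian, and `N` is covered by open sets `U` with smooth functions `f` such that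
`g = e^f g'` with `g'` quaternion Kaehler on `U`, and `θ = df` on `U`. -/
structure IsLCQK
    (g : Π x : N, TangentSpace 𝓘(ℝ, E) x →L[ℝ] TangentSpace 𝓘(ℝ, E) x →L[ℝ] ℝ)
    (H : Π x : N, Submodule ℝ (TangentSpace 𝓘(ℝ, E) x →L[ℝ] TangentSpace 𝓘(ℝ, E) x))
    (θ : Π x : N, TangentSpace 𝓘(ℝ, E) x →L[ℝ] ℝ) : Prop where
  quaternionHermitian : IsQuaternionHermitianOn g H univ
  locallyConformal : ∀ x : N, ∃ U : Set N, IsOpen U ∧ x ∈ U ∧ ∃ f : N → ℝ,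
    ContMDiffOn 𝓘(ℝ, E) 𝓘(ℝ) ∞ f U ∧
    IsQuaternionKaehlerOn (fun y ↦ Real.exp (-f y) • g y) H U ∧
    ∀ y ∈ U, ∀ v : TangentSpace 𝓘(ℝ, E) y, θ y v = d% f y v

/-- The one-form `θ` is parallel for the connection `nabla`. -/
def IsParallelForm
    (nabla : (Π x : N, TangentSpace 𝓘(ℝ, E) x) →
      (Π x : N, TangentSpace 𝓘(ℝ, E) x →L[ℝ] TangentSpace 𝓘(ℝ, E) x))
    (θ : Π x : N, TangentSpace 𝓘(ℝ, E) x →L[ℝ] ℝ) : Prop :=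
  ∀ (Y : Π x : N, TangentSpace 𝓘(ℝ, E) x) (x : N), MDiffAt (T% Y) x →
    ∀ v : TangentSpace 𝓘(ℝ, E) x, d% (fun y ↦ θ y (Y y)) x v = θ x (nabla Y x v)

/-- A smooth distribution: a family of subspaces of the tangent spaces, of constant dimension `k`,
that has a smooth frame near every point. -/
def IsSmoothDistribution (D : Π x : N, Submodule ℝ (TangentSpace 𝓘(ℝ, E) x)) : Prop :=
  ∃ k : ℕ, ∀ x : N, ∃ V : Set N, IsOpen V ∧ x ∈ V ∧
    ∃ X : Fin k → Π y : N, TangentSpace 𝓘(ℝ, E) y,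
      (∀ j, CMDiff[V] ∞ (T% (X j))) ∧
      ∀ y ∈ V, LinearIndependent ℝ (fun j ↦ X j y) ∧
        Submodule.span ℝ (Set.range fun j ↦ X j y) = D y

end Ambient

section Submanifold

variable {E : Type*} [NormedAddCommGroup E] [NormedSpace ℝ E]
  {N : Type*} [TopologicalSpace N] [ChartedSpace E N] [IsManifold 𝓘(ℝ, E) ∞ N]
  {F : Type*} [NormedAddCommGroup F] [NormedSpace ℝ F]
  {M : Type*} [TopologicalSpace M] [ChartedSpace F M] [IsManifold 𝓘(ℝ, F) ∞ M]

/-- `h` is the second fundamental form of the immersion `i : M → N`, defined by the Gauss formula: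
`h u v` is normal to `M`, and for every field `Y` of `N` which is smooth near `i p` and tangent
to `M` along `M` near `p`, with value `di v` at `p`, the vector `∇_(di u) Y - h u v` is tangent
to `M`. -/
structure IsSecondFundamentalForm
    (g : Π x : N, TangentSpace 𝓘(ℝ, E) x →L[ℝ] TangentSpace 𝓘(ℝ, E) x →L[ℝ] ℝ)
    (nabla : (Π x : N, TangentSpace 𝓘(ℝ, E) x) →
      (Π x : N, TangentSpace 𝓘(ℝ, E) x →L[ℝ] TangentSpace 𝓘(ℝ, E) x))
    (i : M → N)
    (h : Π p : M, TangentSpace 𝓘(ℝ, F) p →L[ℝ] TangentSpace 𝓘(ℝ, F) p →L[ℝ]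
      TangentSpace 𝓘(ℝ, E) (i p)) : Prop where
  normal : ∀ (p : M) (u v w : TangentSpace 𝓘(ℝ, F) p),
    g (i p) (h p u v) (mfderiv 𝓘(ℝ, F) 𝓘(ℝ, E) i p w) = 0
  gauss : ∀ (p : M) (u v : TangentSpace 𝓘(ℝ, F) p) (Y : Π x : N, TangentSpace 𝓘(ℝ, E) x),
    CMDiffAt ∞ (T% Y) (i p) →
    (∀ᶠ q in 𝓝 p, ∃ w : TangentSpace 𝓘(ℝ, F) q, Y (i q) = mfderiv 𝓘(ℝ, F) 𝓘(ℝ, E) i q w) →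
    Y (i p) = mfderiv 𝓘(ℝ, F) 𝓘(ℝ, E) i p v →
    ∃ w : TangentSpace 𝓘(ℝ, F) p,
      nabla Y (i p) (mfderiv 𝓘(ℝ, F) 𝓘(ℝ, E) i p u)
        = mfderiv 𝓘(ℝ, F) 𝓘(ℝ, E) i p w + h p u v

/-- The immersion `i` is totally umbilical: `h(u,v) = g(u,v) η` for a field `η` along `M`. Such an
`η` is necessarily the mean curvature vector, that is, the normalized trace of `h`. -/
def IsTotallyUmbilical
    (g : Π x : N, TangentSpace 𝓘(ℝ, E) x →L[ℝ] TangentSpace 𝓘(ℝ, E) x →L[ℝ] ℝ)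
    (nabla : (Π x : N, TangentSpace 𝓘(ℝ, E) x) →
      (Π x : N, TangentSpace 𝓘(ℝ, E) x →L[ℝ] TangentSpace 𝓘(ℝ, E) x))
    (i : M → N) : Prop :=
  ∃ h : Π p : M, TangentSpace 𝓘(ℝ, F) p →L[ℝ] TangentSpace 𝓘(ℝ, F) p →L[ℝ]
      TangentSpace 𝓘(ℝ, E) (i p),
    IsSecondFundamentalForm g nabla i h ∧
    ∃ η : Π p : M, TangentSpace 𝓘(ℝ, E) (i p), ∀ (p : M) (u v : TangentSpace 𝓘(ℝ, F) p),
      h p u v = g (i p) (mfderiv 𝓘(ℝ, F) 𝓘(ℝ, E) i p u) (mfderiv 𝓘(ℝ, F) 𝓘(ℝ, E) i p v) • η p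

/-- The immersed submanifold `i : M → N` is a quaternion CR-submanifold with distributions `D` and
`D'` (the latter is usually written `D^⊥`): they are smooth, orthogonal and complementary
in `TM`; `D` is invariant under `H`, and `H` maps `D'` into the normal bundle of `M`.
Both conditions on `H` are linear, so they hold for `H` if they hold for a local
basis `J_1, J_2, J_3`. -/
structure IsQuaternionCR
    (g : Π x : N, TangentSpace 𝓘(ℝ, E) x →L[ℝ] TangentSpace 𝓘(ℝ, E) x →L[ℝ] ℝ)
    (H : Π x : N, Submodule ℝ (TangentSpace 𝓘(ℝ, E) x →L[ℝ] TangentSpace 𝓘(ℝ, E) x))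
    (i : M → N)
    (D D' : Π p : M, Submodule ℝ (TangentSpace 𝓘(ℝ, F) p)) : Prop where
  smooth : IsSmoothDistribution D
  smooth' : IsSmoothDistribution D'
  orthogonal : ∀ p, ∀ u ∈ D p, ∀ v ∈ D' p,
    g (i p) (mfderiv 𝓘(ℝ, F) 𝓘(ℝ, E) i p u) (mfderiv 𝓘(ℝ, F) 𝓘(ℝ, E) i p v) = 0
  complementary : ∀ p, IsCompl (D p) (D' p)
  invariant : ∀ p, ∀ J ∈ H (i p), ∀ u ∈ D p, ∃ w ∈ D p,
    J (mfderiv 𝓘(ℝ, F) 𝓘(ℝ, E) i p u) = mfderiv 𝓘(ℝ, F) 𝓘(ℝ, E) i p w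
  totallyReal : ∀ p, ∀ J ∈ H (i p), ∀ v ∈ D' p, ∀ w : TangentSpace 𝓘(ℝ, F) p,
    g (i p) (J (mfderiv 𝓘(ℝ, F) 𝓘(ℝ, E) i p v)) (mfderiv 𝓘(ℝ, F) 𝓘(ℝ, E) i p w) = 0

/-- A quaternion CR-submanifold is proper if neither of its two distributions is zero. -/
def IsProper (D D' : Π p : M, Submodule ℝ (TangentSpace 𝓘(ℝ, F) p)) : Prop :=
  ∀ p, D p ≠ ⊥ ∧ D' p ≠ ⊥

/-- `u` and `v`, seen in `TN`, are orthonormal. -/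
def IsOrthonormalPair
    (g : Π x : N, TangentSpace 𝓘(ℝ, E) x →L[ℝ] TangentSpace 𝓘(ℝ, E) x →L[ℝ] ℝ)
    (i : M → N) (p : M) (u v : TangentSpace 𝓘(ℝ, F) p) : Prop :=
  g (i p) (mfderiv 𝓘(ℝ, F) 𝓘(ℝ, E) i p u) (mfderiv 𝓘(ℝ, F) 𝓘(ℝ, E) i p u) = 1 ∧
  g (i p) (mfderiv 𝓘(ℝ, F) 𝓘(ℝ, E) i p v) (mfderiv 𝓘(ℝ, F) 𝓘(ℝ, E) i p v) = 1 ∧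
  g (i p) (mfderiv 𝓘(ℝ, F) 𝓘(ℝ, E) i p u) (mfderiv 𝓘(ℝ, F) 𝓘(ℝ, E) i p v) = 0

end Submanifold

end QCR

end

/-! Locally `g = e^f g'` with `g'` quaternion Kaehler, and the Levi-Civita connection `∇'` of `g'`
differs from `∇` by a term algebraic in `g` and `B` (`cov_conformal`). As `B` is parallel of unit
length, the curvatures `R'` and `R` also differ by an algebraic term (`curvature_conformal`).

Let `X ∈ D`, `Y ∈ D^⊥` be orthonormal and let `J` be one of the local almost complex structures.
Since `JX` is orthogonal to `X` and `Y`, the Codazzi equation of an umbilical submanifold makes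
`R(X,Y)JX` tangent to `M` (`curvature_mem_tangentRange`). The conformal correction is a combination
of `X`, `Y`, `B`, so `R'(X,Y)JX` is tangent too. Now `R'(X,Y)` commutes with `J` up to `H`
(`IsQuaternionFrame.curvature_sub_mem`), and `H` maps `X` into `D`; hence `J R'(X,Y)X` is tangent,
thus orthogonal to the normal vector `JY`, that is, `g(R'(X,Y)X,Y) = 0`. In terms of `R` this reads
`K(X,Y) = (1 - ω(X)² - ω(Y)²)/4` (`sectionalCurvature_eq`), which gives the inequality.

In the proper case all three statements of the second part are false. A nonzero component of `B` in
`D` or `D^⊥`, paired with a vector of the other distribution, has `K < 1/4`. If `g` were quaternion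
Kaehler, `∇` and `∇'` would both preserve `H`; for a vector `W` orthogonal to `B` and `HB` this puts
`|W|² JB / 2` in the span of the `J_b W`, to which it is orthogonal (`not_isQuaternionKaehlerOn`).
-/

noncomputable section

set_option linter.unusedSectionVars false

namespace QCR

/-! ### Smooth germs of functions and vector fields. -/

section SmoothFields

variable {E : Type*} [NormedAddCommGroup E] [NormedSpace ℝ E]
  {N : Type*} [TopologicalSpace N] [ChartedSpace E N] [IsManifold 𝓘(ℝ, E) ∞ N]

/-- The vector field `X` is smooth at all points of a neighbourhood of `x`. -/
def SmoothNear (X : Π x : N, TangentSpace 𝓘(ℝ, E) x) (x : N) : Prop :=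
  ∀ᶠ y in 𝓝 x, CMDiffAt ∞ (T% X) y

variable (E) in
/-- The function `f` is smooth at all points of a neighbourhood of `x`. -/
def SmoothFunNear (f : N → ℝ) (x : N) : Prop :=
  ∀ᶠ y in 𝓝 x, CMDiffAt ∞ f y

/-- The derivative of the function `f` along the vector field `X`. -/
def dir (X : Π x : N, TangentSpace 𝓘(ℝ, E) x) (f : N → ℝ) : N → ℝ := fun y ↦ d% f y (X y)

/-- The covariant derivative `∇_X Y`, as a vector field. -/
def cov (nabla : (Π x : N, TangentSpace 𝓘(ℝ, E) x) →
      (Π x : N, TangentSpace 𝓘(ℝ, E) x →L[ℝ] TangentSpace 𝓘(ℝ, E) x))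
    (X Y : Π x : N, TangentSpace 𝓘(ℝ, E) x) : Π x : N, TangentSpace 𝓘(ℝ, E) x :=
  fun y ↦ nabla Y y (X y)

variable {X Y Z : Π x : N, TangentSpace 𝓘(ℝ, E) x} {f h : N → ℝ} {x : N}

lemma SmoothNear.cmdiffAt (hX : SmoothNear X x) : CMDiffAt ∞ (T% X) x := hX.self_of_nhds

lemma SmoothNear.mdiffAt (hX : SmoothNear X x) : MDiffAt (T% X) x :=
  hX.cmdiffAt.mdifferentiableAt (by simp)

lemma SmoothNear.eventually (hX : SmoothNear X x) : ∀ᶠ y in 𝓝 x, SmoothNear X y :=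
  eventually_eventually_nhds.2 hX

lemma SmoothFunNear.cmdiffAt (hf : SmoothFunNear E f x) : CMDiffAt ∞ f x := hf.self_of_nhds

lemma SmoothFunNear.mdiffAt (hf : SmoothFunNear E f x) : MDiffAt f x :=
  hf.cmdiffAt.mdifferentiableAt (by simp)

lemma SmoothFunNear.eventually (hf : SmoothFunNear E f x) : ∀ᶠ y in 𝓝 x, SmoothFunNear E f y :=
  eventually_eventually_nhds.2 hf

lemma SmoothNear.add (hX : SmoothNear X x) (hY : SmoothNear Y x) : SmoothNear (X + Y) x := by
  filter_upwards [hX, hY] with y h1 h2 using h1.add_section h2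

lemma SmoothNear.sub (hX : SmoothNear X x) (hY : SmoothNear Y x) : SmoothNear (X - Y) x := by
  filter_upwards [hX, hY] with y h1 h2 using h1.sub_section h2

lemma SmoothNear.smul (hf : SmoothFunNear E f x) (hX : SmoothNear X x) : SmoothNear (f • X) x := by
  filter_upwards [hf, hX] with y h1 h2 using h1.smul_section h2

lemma SmoothNear.const_smul (c : ℝ) (hX : SmoothNear X x) : SmoothNear (c • X) x := by
  filter_upwards [hX] with y h1 using h1.const_smul_section

lemma SmoothNear.sum {ι : Type*} (s : Finset ι) {X : ι → Π x : N, TangentSpace 𝓘(ℝ, E) x}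
    (hX : ∀ j, SmoothNear (X j) x) : SmoothNear (∑ j ∈ s, X j) x := by
  classical
  induction s using Finset.induction_on with
  | empty =>
    rw [Finset.sum_empty]
    exact Eventually.of_forall fun y ↦ contMDiff_zeroSection (n := ∞) ℝ (TangentSpace 𝓘(ℝ, E)) y
  | insert a s ha ih => rw [Finset.sum_insert ha]; exact (hX a).add ih

lemma SmoothNear.congr (hX : SmoothNear X x) (h : Y =ᶠ[𝓝 x] X) : SmoothNear Y x := by
  filter_upwards [hX, eventually_eventually_nhds.2 h] with y h1 h2
  refine h1.congr_of_eventuallyEq ?_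
  filter_upwards [h2] with z hz
  rw [hz]

lemma SmoothFunNear.mul (hf : SmoothFunNear E f x) (hh : SmoothFunNear E h x) :
    SmoothFunNear E (f * h) x := by
  filter_upwards [hf, hh] with y h1 h2 using h1.mul h2

lemma SmoothFunNear.const (c : ℝ) : SmoothFunNear E (fun _ : N ↦ c) x :=
  Eventually.of_forall fun _ ↦ contMDiffAt_const

lemma SmoothFunNear.congr (hf : SmoothFunNear E f x) (h' : h =ᶠ[𝓝 x] f) : SmoothFunNear E h x := by
  filter_upwards [hf, eventually_eventually_nhds.2 h'] with y h1 h2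
  exact h1.congr_of_eventuallyEq h2

lemma SmoothFunNear.inv (hf : SmoothFunNear E f x) (h0 : f x ≠ 0) : SmoothFunNear E f⁻¹ x := by
  filter_upwards [hf, hf.cmdiffAt.continuousAt.eventually_ne h0] with y h1 h2
  exact (contDiffAt_inv ℝ h2).contMDiffAt.comp y h1

lemma dir_congr (hfh : f =ᶠ[𝓝 x] h) : dir X f x = dir X h x := by
  simp only [dir, mvfderiv, hfh.mfderiv_eq]
  have := hfh.self_of_nhds
  rfl

lemma SmoothFunNear.dir (hf : SmoothFunNear E f x) (hX : SmoothNear X x) :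
    SmoothFunNear E (dir X f) x := by
  filter_upwards [hf, hX] with y h1 h2
  have h3 := ContMDiffAt.mfderiv_const (m := ∞) h1 (by simp)
  have h4 := ContMDiffAt.clm_apply_of_inCoordinates (b₁ := id) (b₂ := f)
    (ϕ := fun z ↦ mfderiv 𝓘(ℝ, E) 𝓘(ℝ) f z) (v := X) h3 h2 h1
  rw [contMDiffAt_totalSpace] at h4
  refine h4.2.congr_of_eventuallyEq (Eventually.of_forall fun z ↦ ?_)
  simp [QCR.dir, mvfderiv]
  rfl

lemma smoothNear_extend (v : TangentSpace 𝓘(ℝ, E) x) :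
    SmoothNear (FiberBundle.extend E v) x := by
  obtain ⟨s, hs, h⟩ := FiberBundle.exists_contMDiffOn_extend (k := ∞) 𝓘(ℝ, E) E v
  filter_upwards [eventually_mem_nhds_iff.2 hs] with y hy
  exact h.contMDiffAt hy

lemma SmoothNear.mlieBracket [CompleteSpace E] (hX : SmoothNear X x) (hY : SmoothNear Y x) :
    SmoothNear (VectorField.mlieBracket 𝓘(ℝ, E) X Y) x := by
  filter_upwards [hX, hY] with y h1 h2
  have : IsManifold 𝓘(ℝ, E) (minSmoothness ℝ 2) N := by
    rw [minSmoothness_of_isRCLikeNormedField]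
    exact IsManifold.of_le (n := ∞) ENat.LEInfty.out
  have : IsManifold 𝓘(ℝ, E) (((⊤ : ℕ∞) : WithTop ℕ∞) + 1) N := ‹IsManifold 𝓘(ℝ, E) ∞ N›
  exact ContMDiffAt.mlieBracket_vectorField (m := ⊤) (n := ⊤) h1 h2
    (by rw [minSmoothness_of_isRCLikeNormedField]; rfl)

lemma SmoothNear.clm {J : Π y : N, TangentSpace 𝓘(ℝ, E) y →L[ℝ] TangentSpace 𝓘(ℝ, E) y}
    (hJ : ∀ᶠ y in 𝓝 x, ContMDiffAt 𝓘(ℝ, E) (𝓘(ℝ, E).prod 𝓘(ℝ, E →L[ℝ] E)) ∞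
      (fun y ↦ TotalSpace.mk' (E →L[ℝ] E)
        (E := fun y : N ↦ TangentSpace 𝓘(ℝ, E) y →L[ℝ] TangentSpace 𝓘(ℝ, E) y) y (J y)) y)
    (hX : SmoothNear X x) : SmoothNear (fun y ↦ J y (X y)) x := by
  filter_upwards [hJ, hX] with y h1 h2
  exact h1.clm_bundle_apply h2

end SmoothFields

/-! ### Tensoriality over germs of smooth functions. -/

section Tensoriality

variable {E : Type*} [NormedAddCommGroup E] [NormedSpace ℝ E]
  {N : Type*} [TopologicalSpace N] [ChartedSpace E N] [IsManifold 𝓘(ℝ, E) ∞ N]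
  {X Y Z : Π x : N, TangentSpace 𝓘(ℝ, E) x} {f : N → ℝ} {x : N}

/-- The second derivatives of a function commute up to the Lie bracket. -/
lemma dir_dir_sub_dir_dir [CompleteSpace E] (hf : SmoothFunNear E f x) (hX : SmoothNear X x)
    (hY : SmoothNear Y x) :
    dir X (dir Y f) x - dir Y (dir X f) x = dir (VectorField.mlieBracket 𝓘(ℝ, E) X Y) f x := by
  rcases subsingleton_or_nontrivial E with hE | hE
  · have h0 (h : N → ℝ) (W : Π x : N, TangentSpace 𝓘(ℝ, E) x) : dir W h x = 0 := by
      have : W x = 0 := Subsingleton.elim (α := E) _ _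
      simp [dir, this]
    simp [h0]
  -- The identity is read off from the Jacobi identity for `X`, `Y`, `f • W` with `W x ≠ 0`: after
  -- subtracting `f x` times the one for `W`, the mixed first-order terms cancel and only a multiple
  -- of `W x` is left.
  obtain ⟨w, hw⟩ := exists_ne (0 : E)
  set W : Π x : N, TangentSpace 𝓘(ℝ, E) x :=
    FiberBundle.extend E (show TangentSpace 𝓘(ℝ, E) x from w) with hWdef
  have hW : SmoothNear W x := smoothNear_extend _
  have hWx : W x ≠ 0 := by rw [hWdef, FiberBundle.extend_apply_self]; exact hw
  have : IsManifold 𝓘(ℝ, E) (minSmoothness ℝ 3) N := by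
    rw [minSmoothness_of_isRCLikeNormedField]
    exact IsManifold.of_le (n := ∞) ENat.LEInfty.out
  have h2 : minSmoothness ℝ 2 ≤ (∞ : WithTop ℕ∞) := by
    rw [minSmoothness_of_isRCLikeNormedField]; exact ENat.LEInfty.out
  have smulB (A V : Π x : N, TangentSpace 𝓘(ℝ, E) x) (h : N → ℝ) {y : N}
      (hh : SmoothFunNear E h y) (hV : SmoothNear V y) :
      VectorField.mlieBracket 𝓘(ℝ, E) A (h • V) y
        = dir A h y • V y + h y • VectorField.mlieBracket 𝓘(ℝ, E) A V y :=
    VectorField.mlieBracket_smul_right hh.mdiffAt hV.mdiffAt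
  have twice (A V : Π x : N, TangentSpace 𝓘(ℝ, E) x) (hA : SmoothNear A x) (hV : SmoothNear V x) :
      VectorField.mlieBracket 𝓘(ℝ, E) A (VectorField.mlieBracket 𝓘(ℝ, E) V (f • W)) x
        = dir A (dir V f) x • W x + dir V f x • VectorField.mlieBracket 𝓘(ℝ, E) A W x
          + (dir A f x • VectorField.mlieBracket 𝓘(ℝ, E) V W x
          + f x • VectorField.mlieBracket 𝓘(ℝ, E) A (VectorField.mlieBracket 𝓘(ℝ, E) V W) x) := by
    have hev : VectorField.mlieBracket 𝓘(ℝ, E) V (f • W) =ᶠ[𝓝 x]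
        dir V f • W + f • VectorField.mlieBracket 𝓘(ℝ, E) V W := by
      filter_upwards [hf.eventually, hW.eventually] with y h1 h2
      exact smulB V W f h1 h2
    rw [Filter.EventuallyEq.mlieBracket_vectorField_eq (EventuallyEq.refl _ A) hev,
      VectorField.mlieBracket_add_right ((hf.dir hV |>.mdiffAt).smul_section hW.mdiffAt)
        (hf.mdiffAt.smul_section (hV.mlieBracket hW).mdiffAt),
      smulB A W _ (hf.dir hV) hW, smulB A _ f hf (hV.mlieBracket hW)]
  have jac (V : Π x : N, TangentSpace 𝓘(ℝ, E) x) (hV : SmoothNear V x) :=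
    VectorField.leibniz_identity_mlieBracket_apply (hX.cmdiffAt.of_le h2) (hY.cmdiffAt.of_le h2)
      (hV.cmdiffAt.of_le h2)
  have e1 := jac (f • W) (SmoothNear.smul hf hW)
  have e2 := jac W hW
  rw [twice X Y hX hY, twice Y X hY hX, smulB _ W f hf hW, e2] at e1
  have e3 : (dir X (dir Y f) x - dir Y (dir X f) x
      - dir (VectorField.mlieBracket 𝓘(ℝ, E) X Y) f x) • W x = 0 := by
    rw [← sub_eq_zero] at e1
    rw [← e1]
    module
  rcases smul_eq_zero.1 e3 with h | h
  · linarith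
  · exact absurd h hWx

/-- The operation `Φ` on vector fields that are smooth near `x` is linear over the functions that
are smooth near `x`. -/
structure SmoothTensorialAt {A : Type*} [AddCommGroup A] [Module ℝ A]
    (Φ : (Π x : N, TangentSpace 𝓘(ℝ, E) x) → A) (x : N) : Prop where
  smul : ∀ {f : N → ℝ} {X}, SmoothFunNear E f x → SmoothNear X x → Φ (f • X) = f x • Φ X
  add : ∀ {X Y}, SmoothNear X x → SmoothNear Y x → Φ (X + Y) = Φ X + Φ Y

namespace SmoothTensorialAt

variable {A : Type*} [AddCommGroup A] [Module ℝ A]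
    {Φ : (Π x : N, TangentSpace 𝓘(ℝ, E) x) → A}

/-- Scalars need to be smooth only near `x`, so the indicator of the set where the two fields agree
is an admissible cutoff; no bump function is needed. -/
lemma congr_germ (hΦ : SmoothTensorialAt Φ x) (hX : SmoothNear X x) (hY : SmoothNear Y x)
    (h : X =ᶠ[𝓝 x] Y) : Φ X = Φ Y := by
  classical
  let ψ (y : N) : ℝ := if X y = Y y then 1 else 0
  have hψx : ψ x = 1 := by simp [ψ, h.self_of_nhds]
  have hXY : ψ • X = ψ • Y := by
    funext y
    dsimp [ψ]
    split_ifs with hy <;> simp [hy]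
  have hψ : SmoothFunNear E ψ x :=
    (SmoothFunNear.const 1).congr (h.mono fun y hy ↦ by simp [ψ, hy])
  have h1 := hΦ.smul hψ hX
  rw [hXY, hΦ.smul hψ hY, hψx, one_smul, one_smul] at h1
  exact h1.symm

lemma sum (hΦ : SmoothTensorialAt Φ x) {ι : Type*} (s : Finset ι)
    {X : ι → Π x : N, TangentSpace 𝓘(ℝ, E) x} (hX : ∀ j, SmoothNear (X j) x) :
    Φ (∑ j ∈ s, X j) = ∑ j ∈ s, Φ (X j) := by
  classical
  induction s using Finset.induction_on with
  | empty =>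
    have h0 : SmoothNear (0 : Π x : N, TangentSpace 𝓘(ℝ, E) x) x := by
      simpa using SmoothNear.sum ∅ hX
    simpa using hΦ.smul (SmoothFunNear.const 0) h0
  | insert a s ha ih =>
    rw [Finset.sum_insert ha, Finset.sum_insert ha, hΦ.add (hX a) (SmoothNear.sum s hX), ih]

/-- A tensorial operation depends only on the value of the vector field at the point. -/
lemma pointwise [FiniteDimensional ℝ E] (hΦ : SmoothTensorialAt Φ x) (hX : SmoothNear X x)
    (hY : SmoothNear Y x) (h : X x = Y x) : Φ X = Φ Y := by
  let t := trivializationAt E (TangentSpace 𝓘(ℝ, E)) x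
  have x_mem : x ∈ t.baseSet := FiberBundle.mem_baseSet_trivializationAt E _ x
  have ev : ∀ᶠ y in 𝓝 x, y ∈ t.baseSet := t.open_baseSet.mem_nhds x_mem
  let b := Module.Basis.ofVectorSpace ℝ E
  let s := t.localFrame b
  let c := t.localFrameCoeff 𝓘(ℝ, E) b
  have hs (i) : SmoothNear (s i) x := by
    filter_upwards [ev] with y hy using contMDiffAt_localFrame_of_mem ∞ _ b i hy
  have hc {X : Π x : N, TangentSpace 𝓘(ℝ, E) x} (hX : SmoothNear X x) (i) :
      SmoothFunNear E (LinearMap.piApply (c i) X) x := by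
    filter_upwards [ev, hX] with y hy h1 using contMDiffAt_localFrameCoeff b hy h1 i
  have key {X : Π x : N, TangentSpace 𝓘(ℝ, E) x} (hX : SmoothNear X x) :
      Φ X = ∑ i, c i x (X x) • Φ (s i) := by
    have h1 : Φ X = Φ (∑ i, LinearMap.piApply (c i) X • s i) := by
      refine hΦ.congr_germ hX (SmoothNear.sum _ fun i ↦ SmoothNear.smul (hc hX i) (hs i)) ?_
      filter_upwards [t.eventually_eq_localFrame_sum_coeff_smul (I := 𝓘(ℝ, E)) b (s := X) x_mem]
        with y hy
      rw [hy, Finset.sum_apply]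
      rfl
    rw [h1, hΦ.sum _ fun i ↦ SmoothNear.smul (hc hX i) (hs i)]
    exact Finset.sum_congr rfl fun i _ ↦ hΦ.smul (hc hX i) (hs i)
  rw [key hX, key hY, h]

end SmoothTensorialAt

end Tensoriality

/-! ### Levi-Civita connections and the symmetries of their curvature. -/

section Connection

variable {E : Type*} [NormedAddCommGroup E] [NormedSpace ℝ E]
  {N : Type*} [TopologicalSpace N] [ChartedSpace E N] [IsManifold 𝓘(ℝ, E) ∞ N]
  {g : Π x : N, TangentSpace 𝓘(ℝ, E) x →L[ℝ] TangentSpace 𝓘(ℝ, E) x →L[ℝ] ℝ}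
  {nabla : (Π x : N, TangentSpace 𝓘(ℝ, E) x) →
      (Π x : N, TangentSpace 𝓘(ℝ, E) x →L[ℝ] TangentSpace 𝓘(ℝ, E) x)}
  {U : Set N} {X X' Y Y' Z Z' W : Π x : N, TangentSpace 𝓘(ℝ, E) x} {f : N → ℝ} {x : N}

lemma curvature_eq_cov : curvature nabla X Y Z x = cov nabla X (cov nabla Y Z) x
    - cov nabla Y (cov nabla X Z) x - cov nabla (VectorField.mlieBracket 𝓘(ℝ, E) X Y) Z x := rfl

lemma cov_smul_left : cov nabla (f • X) Y = f • cov nabla X Y := by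
  funext y; simp [cov]

lemma cov_add_left : cov nabla (X + X') Y = cov nabla X Y + cov nabla X' Y := by
  funext y; simp [cov]

lemma curvature_swap : curvature nabla X Y Z x = - curvature nabla Y X Z x := by
  simp only [curvature, VectorField.mlieBracket_swap_apply (V := X), map_neg]
  abel

namespace IsLeviCivitaOn

variable (hn : IsLeviCivitaOn g nabla U) (hU : U ∈ 𝓝 x)
include hn hU

lemma smoothNear_cov (hX : SmoothNear X x) (hY : SmoothNear Y x) :
    SmoothNear (cov nabla X Y) x := by
  filter_upwards [hX, hY, hU] with y h1 h2 h3 using hn.smooth X Y y h3 h1 h2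

lemma cov_congr (hY : SmoothNear Y x) (hY' : SmoothNear Y' x) (h : Y =ᶠ[𝓝 x] Y') :
    cov nabla X Y x = cov nabla X Y' x := by
  simp only [cov]
  rw [hn.isCovariantDerivativeOn.congr_of_eventuallyEq hY.mdiffAt hY'.mdiffAt hU h]

lemma cov_add (hY : SmoothNear Y x) (hY' : SmoothNear Y' x) :
    cov nabla X (Y + Y') x = cov nabla X Y x + cov nabla X Y' x := by
  simp only [cov]
  rw [hn.isCovariantDerivativeOn.add hY.mdiffAt hY'.mdiffAt (mem_of_mem_nhds hU)]
  rfl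

lemma cov_smul (hf : SmoothFunNear E f x) (hY : SmoothNear Y x) :
    cov nabla X (f • Y) x = f x • cov nabla X Y x + dir X f x • Y x := by
  simp only [cov]
  rw [hn.isCovariantDerivativeOn.leibniz hY.mdiffAt hf.mdiffAt (mem_of_mem_nhds hU)]
  rfl

lemma cov_const_smul (c : ℝ) (hY : SmoothNear Y x) :
    cov nabla X (c • Y) x = c • cov nabla X Y x := by
  simp only [cov]
  rw [hn.isCovariantDerivativeOn.smul_const c hY.mdiffAt (mem_of_mem_nhds hU)]
  rfl

lemma cov_sub (hY : SmoothNear Y x) (hY' : SmoothNear Y' x) :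
    cov nabla X (Y - Y') x = cov nabla X Y x - cov nabla X Y' x := by
  have h : Y - Y' = Y + (-1 : ℝ) • Y' := by module
  rw [h, hn.cov_add hU hY (hY'.const_smul _), hn.cov_const_smul hU _ hY']
  module

lemma cov_sum {ι : Type*} (s : Finset ι) {Y : ι → Π x : N, TangentSpace 𝓘(ℝ, E) x}
    (hY : ∀ j, SmoothNear (Y j) x) :
    cov nabla X (∑ j ∈ s, Y j) x = ∑ j ∈ s, cov nabla X (Y j) x := by
  classical
  induction s using Finset.induction_on with
  | empty =>
    simp only [Finset.sum_empty, cov]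
    rw [hn.isCovariantDerivativeOn.zero (mem_of_mem_nhds hU)]
    rfl
  | insert a s ha ih =>
    rw [Finset.sum_insert ha, Finset.sum_insert ha, hn.cov_add hU (hY a) (SmoothNear.sum s hY), ih]

lemma cov_sub_cov (hX : SmoothNear X x) (hY : SmoothNear Y x) :
    cov nabla X Y x - cov nabla Y X x = VectorField.mlieBracket 𝓘(ℝ, E) X Y x :=
  hn.torsion_free X Y x (mem_of_mem_nhds hU) hX.mdiffAt hY.mdiffAt

lemma dir_metric (hY : SmoothNear Y x) (hZ : SmoothNear Z x) :
    dir X (fun y ↦ g y (Y y) (Z y)) x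
      = g x (cov nabla X Y x) (Z x) + g x (Y x) (cov nabla X Z x) :=
  hn.metric Y Z x (mem_of_mem_nhds hU) hY.mdiffAt hZ.mdiffAt _

lemma cov_cov_smul (hf : SmoothFunNear E f x) (hY : SmoothNear Y x)
    (hZ : SmoothNear Z x) :
    cov nabla X (cov nabla Y (f • Z)) x = f x • cov nabla X (cov nabla Y Z) x
      + dir X f x • cov nabla Y Z x + (dir Y f x • cov nabla X Z x + dir X (dir Y f) x • Z x) := by
  have hYZ := hn.smoothNear_cov hU hY hZ
  have ev : cov nabla Y (f • Z) =ᶠ[𝓝 x] f • cov nabla Y Z + dir Y f • Z := by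
    filter_upwards [hf.eventually, hZ.eventually, eventually_mem_nhds_iff.2 hU] with y h1 h2 h3
    exact hn.cov_smul h3 h1 h2
  rw [hn.cov_congr hU (hn.smoothNear_cov hU hY (.smul hf hZ))
    ((SmoothNear.smul hf hYZ).add (.smul (hf.dir hY) hZ)) ev,
    hn.cov_add hU (SmoothNear.smul hf hYZ) (.smul (hf.dir hY) hZ),
    hn.cov_smul hU hf hYZ, hn.cov_smul hU (hf.dir hY) hZ]

/-- The second derivatives of the factor `f` enter as `XYf - YXf - [X,Y]f`, which vanishes by
`dir_dir_sub_dir_dir`. -/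
lemma smoothTensorialAt_curvature_right [CompleteSpace E] (hX : SmoothNear X x)
    (hY : SmoothNear Y x) : SmoothTensorialAt (fun Z ↦ curvature nabla X Y Z x) x where
  smul {f Z} hf hZ := by
    have hd := dir_dir_sub_dir_dir hf hX hY
    simp only [curvature_eq_cov]
    rw [hn.cov_cov_smul hU hf hY hZ, hn.cov_cov_smul hU hf hX hZ, hn.cov_smul hU hf hZ, ← hd]
    module
  add {Z Z'} hZ hZ' := by
    have ev (Y : Π x : N, TangentSpace 𝓘(ℝ, E) x) :
        cov nabla Y (Z + Z') =ᶠ[𝓝 x] cov nabla Y Z + cov nabla Y Z' := by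
      filter_upwards [hZ.eventually, hZ'.eventually, eventually_mem_nhds_iff.2 hU] with y h1 h2 h3
      exact hn.cov_add h3 h1 h2
    have key (X : Π x : N, TangentSpace 𝓘(ℝ, E) x) {Y} (hY : SmoothNear Y x) :
        cov nabla X (cov nabla Y (Z + Z')) x
          = cov nabla X (cov nabla Y Z) x + cov nabla X (cov nabla Y Z') x := by
      have h1 := hn.smoothNear_cov hU hY hZ
      have h2 := hn.smoothNear_cov hU hY hZ'
      rw [hn.cov_congr hU (hn.smoothNear_cov hU hY (hZ.add hZ')) (h1.add h2) (ev Y),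
        hn.cov_add hU h1 h2]
    simp only [curvature_eq_cov]
    rw [key X hY, key Y hX, hn.cov_add hU hZ hZ']
    abel

/-- The derivative of `f` in `∇_Y (f ∇_X Z)` cancels against the one produced by the bracket `[fX,
Y]`. -/
lemma smoothTensorialAt_curvature_left [CompleteSpace E]
    (hZ : SmoothNear Z x) : SmoothTensorialAt (fun X ↦ curvature nabla X Y Z x) x where
  smul {f X} hf hX := by
    have hXZ := hn.smoothNear_cov hU hX hZ
    have h2 : cov nabla (VectorField.mlieBracket 𝓘(ℝ, E) (f • X) Y) Z x
        = - dir Y f x • cov nabla X Z x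
          + f x • cov nabla (VectorField.mlieBracket 𝓘(ℝ, E) X Y) Z x := by
      simp only [cov]
      rw [VectorField.mlieBracket_smul_left hf.mdiffAt hX.mdiffAt]
      simp [dir]
    simp only [curvature_eq_cov]
    rw [h2, cov_smul_left, cov_smul_left, hn.cov_smul hU hf hXZ]
    simp only [Pi.smul_apply']
    module
  add {X X'} hX hX' := by
    have h1 := hn.smoothNear_cov hU hX hZ
    have h1' := hn.smoothNear_cov hU hX' hZ
    have h2 : cov nabla (VectorField.mlieBracket 𝓘(ℝ, E) (X + X') Y) Z x
        = cov nabla (VectorField.mlieBracket 𝓘(ℝ, E) X Y) Z x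
          + cov nabla (VectorField.mlieBracket 𝓘(ℝ, E) X' Y) Z x := by
      simp only [cov]
      rw [VectorField.mlieBracket_add_left hX.mdiffAt hX'.mdiffAt, map_add]
    simp only [curvature_eq_cov]
    rw [h2, cov_add_left, cov_add_left, hn.cov_add hU h1 h1', Pi.add_apply]
    abel

/-- The curvature is a tensor. -/
lemma curvature_congr [FiniteDimensional ℝ E] (hX : SmoothNear X x) (hY : SmoothNear Y x)
    (hZ : SmoothNear Z x) (hX' : SmoothNear X' x) (hY' : SmoothNear Y' x) (hZ' : SmoothNear Z' x)
    (eX : X x = X' x) (eY : Y x = Y' x) (eZ : Z x = Z' x) :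
    curvature nabla X Y Z x = curvature nabla X' Y' Z' x := by
  have := FiniteDimensional.complete ℝ E
  rw [(hn.smoothTensorialAt_curvature_left hU hZ).pointwise hX hX' eX,
    curvature_swap, (hn.smoothTensorialAt_curvature_left hU hZ).pointwise hY hY' eY,
    ← curvature_swap, (hn.smoothTensorialAt_curvature_right hU hX' hY').pointwise hZ hZ' eZ]

end IsLeviCivitaOn

lemma smoothFunNear_metric (g : ContMDiffRiemannianMetric 𝓘(ℝ, E) ∞ E
    (fun x : N ↦ TangentSpace 𝓘(ℝ, E) x)) (hX : SmoothNear X x) (hY : SmoothNear Y x) :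
    SmoothFunNear E (fun y ↦ g.inner y (X y) (Y y)) x := by
  filter_upwards [hX, hY] with y h1 h2
  have : ContMDiffAt 𝓘(ℝ, E) (𝓘(ℝ, E).prod 𝓘(ℝ)) ∞ (fun m ↦ TotalSpace.mk' ℝ
      (E := Bundle.Trivial N ℝ) m (g.inner m (X m) (Y m))) y :=
    ContMDiffAt.clm_bundle_apply₂ (F₁ := E) (F₂ := E) (E₁ := TangentSpace 𝓘(ℝ, E))
      (E₂ := TangentSpace 𝓘(ℝ, E)) (E₃ := Bundle.Trivial N ℝ) (b := fun m ↦ m)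
      (ψ := g.inner) (g.contMDiff y) h1 h2
  rw [contMDiffAt_totalSpace] at this
  exact this.2

/-- The curvature of a Levi-Civita connection is skew-symmetric. -/
lemma curvature_skew [CompleteSpace E] {g : ContMDiffRiemannianMetric 𝓘(ℝ, E) ∞ E
    (fun x : N ↦ TangentSpace 𝓘(ℝ, E) x)} (hn : IsLeviCivitaOn g.inner nabla univ)
    (hX : SmoothNear X x) (hY : SmoothNear Y x) (hZ : SmoothNear Z x) (hW : SmoothNear W x) :
    g.inner x (curvature nabla X Y Z x) (W x) + g.inner x (Z x) (curvature nabla X Y W x) = 0 := by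
  have twice {A V : Π x : N, TangentSpace 𝓘(ℝ, E) x} (hV : SmoothNear V x) :
      dir A (dir V fun y ↦ g.inner y (Z y) (W y)) x
        = (g.inner x (cov nabla A (cov nabla V Z) x) (W x)
            + g.inner x (cov nabla V Z x) (cov nabla A W x))
          + (g.inner x (cov nabla A Z x) (cov nabla V W x)
            + g.inner x (Z x) (cov nabla A (cov nabla V W) x)) := by
    have ev : dir V (fun y ↦ g.inner y (Z y) (W y)) =ᶠ[𝓝 x]
        (fun y ↦ g.inner y (cov nabla V Z y) (W y)) + fun y ↦ g.inner y (Z y) (cov nabla V W y) := by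
      filter_upwards [hZ.eventually, hW.eventually] with y h1 h2
      exact hn.dir_metric univ_mem h1 h2
    have hVZ := hn.smoothNear_cov univ_mem hV hZ
    have hVW := hn.smoothNear_cov univ_mem hV hW
    rw [dir_congr ev, ← hn.dir_metric univ_mem hVZ hW, ← hn.dir_metric univ_mem hZ hVW]
    simp only [dir]
    rw [mvfderiv_add (smoothFunNear_metric g hVZ hW).mdiffAt (smoothFunNear_metric g hZ hVW).mdiffAt]
    rfl
  -- Differentiating `g(Z,W)` twice, the terms `g(∇Z, ∇W)` are symmetric in `X` and `Y` and drop out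
  -- of the commutator.
  have h := dir_dir_sub_dir_dir (smoothFunNear_metric g hZ hW) hX hY
  rw [twice hY, twice hX, hn.dir_metric univ_mem hZ hW] at h
  simp only [curvature_eq_cov, map_sub, sub_apply]
  linarith

end Connection

/-! ### Conformal change of the connection and of the curvature. -/

section Weyl

variable {E : Type*} [NormedAddCommGroup E] [NormedSpace ℝ E]
  {N : Type*} [TopologicalSpace N] [ChartedSpace E N] [IsManifold 𝓘(ℝ, E) ∞ N]
  {g : ContMDiffRiemannianMetric 𝓘(ℝ, E) ∞ E (fun x : N ↦ TangentSpace 𝓘(ℝ, E) x)}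
  {nabla nabla' : (Π x : N, TangentSpace 𝓘(ℝ, E) x) →
      (Π x : N, TangentSpace 𝓘(ℝ, E) x →L[ℝ] TangentSpace 𝓘(ℝ, E) x)}
  {U : Set N} {X Y Z W B : Π x : N, TangentSpace 𝓘(ℝ, E) x} {f : N → ℝ} {x : N}

lemma eq_zero_of_inner_eq_zero {u : TangentSpace 𝓘(ℝ, E) x} (h : ∀ w, g.inner x u w = 0) :
    u = 0 := by
  by_contra hu
  exact (g.pos x u hu).ne' (h u)

lemma mvfderiv_exp_neg (hf : MDiffAt f x) (v : TangentSpace 𝓘(ℝ, E) x) :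
    d% (fun y ↦ Real.exp (-f y)) x v = - (Real.exp (-f x) * d% f x v) := by
  have h1 : HasMFDerivAt 𝓘(ℝ, E) 𝓘(ℝ) (fun y ↦ Real.exp (-f y)) x _ :=
    HasMFDerivAt.comp x (g := fun t : ℝ ↦ Real.exp (-t))
      ((Real.hasDerivAt_exp (-f x)).comp (f x) (hasDerivAt_neg (f x))).hasFDerivAt.hasMFDerivAt
      hf.hasMFDerivAt
  have h2 := h1.mfderiv
  simp only [mul_neg, mul_one] at h2
  simp only [mvfderiv, h2]
  change d% f x v * (-Real.exp (-f x)) = -(Real.exp (-f x) * d% f x v)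
  ring

/-- The Levi-Civita connections of conformal metrics differ by the usual term. -/
lemma cov_conformal (hn : IsLeviCivitaOn g.inner nabla univ)
    (hn' : IsLeviCivitaOn (fun y ↦ Real.exp (-f y) • g.inner y) nabla' U) (hU : U ∈ 𝓝 x)
    (hf : MDiffAt f x) {b : TangentSpace 𝓘(ℝ, E) x} (hb : ∀ v, d% f x v = g.inner x v b)
    (hX : SmoothNear X x) (hY : SmoothNear Y x) :
    cov nabla' X Y x = cov nabla X Y x - (1 / 2 : ℝ) • (g.inner x (X x) b • Y x
      + g.inner x (Y x) b • X x - g.inner x (X x) (Y x) • b) := by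
  -- `S` is the defect of the claimed formula. Torsion-freeness makes `S(X,Y)` symmetric, and
  -- compatibility with both metrics makes `g(S(X,Y),Z)` skew in `Y`, `Z`. An expression with both
  -- symmetries vanishes, as for the uniqueness of the Levi-Civita connection.
  set S : (Π x : N, TangentSpace 𝓘(ℝ, E) x) → (Π x : N, TangentSpace 𝓘(ℝ, E) x) →
      TangentSpace 𝓘(ℝ, E) x := fun X Y ↦ cov nabla' X Y x - cov nabla X Y x
        + (1 / 2 : ℝ) • (g.inner x (X x) b • Y x + g.inner x (Y x) b • X x
          - g.inner x (X x) (Y x) • b) with hS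
  have symm {X Y} (hX : SmoothNear X x) (hY : SmoothNear Y x) : S X Y = S Y X := by
    have h1 := hn.cov_sub_cov univ_mem hX hY
    rw [← hn'.cov_sub_cov hU hX hY, ← sub_eq_zero] at h1
    rw [← sub_eq_zero, ← neg_eq_zero, ← h1]
    simp only [hS, g.symm x (X x) (Y x)]
    module
  have skew (X) {Y Z} (hY : SmoothNear Y x) (hZ : SmoothNear Z x) :
      g.inner x (S X Y) (Z x) + g.inner x (S X Z) (Y x) = 0 := by
    have h1 := hn.dir_metric univ_mem (X := X) hY hZ
    have h2 := hn'.dir_metric hU (X := X) hY hZ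
    have h3 : dir X (fun y ↦ (Real.exp (-f y) • g.inner y) (Y y) (Z y)) x
        = Real.exp (-f x) * dir X (fun y ↦ g.inner y (Y y) (Z y)) x
          - Real.exp (-f x) * g.inner x (X x) b * g.inner x (Y x) (Z x) := by
      have he : MDiffAt (fun y ↦ Real.exp (-f y)) x :=
        ((Real.differentiable_exp.comp differentiable_neg) (f x)).mdifferentiableAt.comp x hf
      have h4 := mvfderiv_mul he (smoothFunNear_metric g hY hZ).mdiffAt
      have h5 := congrArg (fun L ↦ L (X x)) h4
      simp only [dir]
      refine Eq.trans h5 ?_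
      simp [mvfderiv_exp_neg hf, hb]
      ring
    have he := Real.exp_pos (-f x)
    rw [h3, h1] at h2
    simp only [smul_apply, smul_eq_mul] at h2
    have h6 : g.inner x (cov nabla X Y x) (Z x) + g.inner x (Y x) (cov nabla X Z x)
        - g.inner x (X x) b * g.inner x (Y x) (Z x)
        = g.inner x (cov nabla' X Y x) (Z x) + g.inner x (Y x) (cov nabla' X Z x) := by
      apply mul_left_cancel₀ he.ne'
      linarith
    simp only [hS, map_add, map_sub, map_smul, add_apply, sub_apply, smul_apply, smul_eq_mul,
      g.symm x (cov nabla X Z x), g.symm x (cov nabla' X Z x), g.symm x (Z x) (Y x),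
      g.symm x b]
    linarith
  have h0 : S X Y = 0 := by
    refine eq_zero_of_inner_eq_zero (g := g) fun w ↦ ?_
    obtain ⟨Z, hZ, rfl⟩ : ∃ Z : Π x : N, TangentSpace 𝓘(ℝ, E) x, SmoothNear Z x ∧ Z x = w :=
      ⟨_, smoothNear_extend w, FiberBundle.extend_apply_self ..⟩
    have e1 := skew X hY hZ
    have e2 := skew Y hZ hX
    have e3 := skew Z hX hY
    rw [symm hZ hX] at e3
    rw [symm hZ hY] at e3
    rw [symm hY hX] at e2
    linarith
  rw [hS] at h0
  rw [← sub_eq_zero, ← h0]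
  module

lemma exists_smoothNear_eq (w : TangentSpace 𝓘(ℝ, E) x) :
    ∃ Z : Π x : N, TangentSpace 𝓘(ℝ, E) x, SmoothNear Z x ∧ Z x = w :=
  ⟨_, smoothNear_extend w, FiberBundle.extend_apply_self ..⟩

/-- The Lee field is smooth. -/
lemma smoothNear_of_conformal (hn : IsLeviCivitaOn g.inner nabla univ)
    (hn' : IsLeviCivitaOn (fun y ↦ Real.exp (-f y) • g.inner y) nabla' U) (hU : U ∈ 𝓝 x)
    (hf : SmoothFunNear E f x) (hB : ∀ᶠ y in 𝓝 x, ∀ v, d% f y v = g.inner y v (B y))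
    (hBx : B x ≠ 0) : SmoothNear B x := by
  -- The conformal formula with both arguments equal to `Y` can be solved for `B`: `g(Y,Y) B =
  -- 2(∇'_Y Y - ∇_Y Y) + 2 (Yf) Y`. The choice `Y x = B x` serves only to make `g(Y,Y)` nonzero.
  obtain ⟨Y, hY, hYx⟩ := exists_smoothNear_eq (B x)
  have hφ := smoothFunNear_metric g hY hY
  have hφx : g.inner x (Y x) (Y x) ≠ 0 := by rw [hYx]; exact (g.pos x _ hBx).ne'
  have hsm : SmoothNear ((fun y ↦ g.inner y (Y y) (Y y))⁻¹ •
      ((2 : ℝ) • (cov nabla' Y Y - cov nabla Y Y) + (2 : ℝ) • (dir Y f • Y))) x :=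
    .smul (hφ.inv hφx) ((((hn'.smoothNear_cov hU hY hY).sub
      (hn.smoothNear_cov univ_mem hY hY)).const_smul _).add
      ((SmoothNear.smul (hf.dir hY) hY).const_smul _))
  refine hsm.congr ?_
  filter_upwards [hB, hf.eventually, hY.eventually, eventually_mem_nhds_iff.2 hU,
    hφ.cmdiffAt.continuousAt.eventually_ne hφx] with y h1 h2 h3 h4 h5
  have h6 := cov_conformal hn hn' h4 h2.mdiffAt h1 h3 h3
  have h7 : dir Y f y = g.inner y (Y y) (B y) := h1 _
  simp only [Pi.smul_apply', Pi.smul_apply, Pi.add_apply, Pi.sub_apply, Pi.inv_apply, h6, h7]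
  refine (eq_inv_smul_iff₀ (α := ℝ) (β := TangentSpace 𝓘(ℝ, E) y) h5).2 ?_
  module

/-- The metric dual of a smooth parallel form is parallel. -/
lemma cov_eq_zero_of_parallel (hn : IsLeviCivitaOn g.inner nabla univ)
    {θ : Π x : N, TangentSpace 𝓘(ℝ, E) x →L[ℝ] ℝ} (hθ : IsParallelForm nabla θ)
    (hB : ∀ (x : N) (v : TangentSpace 𝓘(ℝ, E) x), θ x v = g.inner x v (B x))
    (hBs : SmoothNear B x) : cov nabla X B x = 0 := by
  refine eq_zero_of_inner_eq_zero (g := g) fun w ↦ ?_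
  obtain ⟨Z, hZ, rfl⟩ := exists_smoothNear_eq w
  have h1 := hn.dir_metric univ_mem (X := X) hZ hBs
  have h2 := hθ Z x hZ.mdiffAt (X x)
  simp only [hB] at h2
  change dir X (fun y ↦ g.inner y (Z y) (B y)) x = g.inner x (cov nabla X Z x) (B x) at h2
  rw [g.symm]
  linarith

/-- Comparison of the curvatures of conformal metrics, if the Lee form is parallel of unit
length. -/
lemma curvature_conformal [CompleteSpace E] (hn : IsLeviCivitaOn g.inner nabla univ)
    (hn' : IsLeviCivitaOn (fun y ↦ Real.exp (-f y) • g.inner y) nabla' U) (hU : U ∈ 𝓝 x)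
    (hf : SmoothFunNear E f x) (hB : ∀ᶠ y in 𝓝 x, ∀ v, d% f y v = g.inner y v (B y))
    (hBs : SmoothNear B x) (hB1 : g.inner x (B x) (B x) = 1)
    (hpar : ∀ X : Π x : N, TangentSpace 𝓘(ℝ, E) x, cov nabla X B x = 0)
    (hX : SmoothNear X x) (hY : SmoothNear Y x) (hZ : SmoothNear Z x) :
    curvature nabla' X Y Z x = curvature nabla X Y Z x + (1 / 4 : ℝ) •
      ((g.inner x (Y x) (B x) * g.inner x (Z x) (B x)) • X x
        - (g.inner x (X x) (B x) * g.inner x (Z x) (B x)) • Y x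
        - g.inner x (Y x) (Z x) • X x + g.inner x (X x) (Z x) • Y x
        - (g.inner x (Y x) (B x) * g.inner x (X x) (Z x)) • B x
        + (g.inner x (X x) (B x) * g.inner x (Y x) (Z x)) • B x) := by
  have twice {A V : Π x : N, TangentSpace 𝓘(ℝ, E) x} (hA : SmoothNear A x)
      (hV : SmoothNear V x) := by
    -- Near `x`, `∇'_V Z = ∇_V Z - T/2`. As `B` is parallel, differentiating `T` only brings in
    -- derivatives of `V` and `Z`.
    let T : Π x : N, TangentSpace 𝓘(ℝ, E) x := (fun y ↦ g.inner y (V y) (B y)) • Z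
      + (fun y ↦ g.inner y (Z y) (B y)) • V - (fun y ↦ g.inner y (V y) (Z y)) • B
    have hVB := smoothFunNear_metric g hV hBs
    have hZB := smoothFunNear_metric g hZ hBs
    have hVZ := smoothFunNear_metric g hV hZ
    have hT : SmoothNear T x :=
      ((SmoothNear.smul hVB hZ).add (.smul hZB hV)).sub (.smul hVZ hBs)
    have hcov := hn.smoothNear_cov univ_mem hV hZ
    have hcov' := hn'.smoothNear_cov hU hV hZ
    have ev : cov nabla' V Z =ᶠ[𝓝 x] cov nabla V Z - (1 / 2 : ℝ) • T := by
      filter_upwards [hB, hf.eventually, hV.eventually, hZ.eventually,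
        eventually_mem_nhds_iff.2 hU] with y h1 h2 h3 h4 h5
      exact cov_conformal hn hn' h5 h2.mdiffAt h1 h3 h4
    have e1 : cov nabla A T x = (g.inner x (V x) (B x)) • cov nabla A Z x
        + g.inner x (cov nabla A V x) (B x) • Z x
        + ((g.inner x (Z x) (B x)) • cov nabla A V x + g.inner x (cov nabla A Z x) (B x) • V x)
        - (g.inner x (cov nabla A V x) (Z x) + g.inner x (V x) (cov nabla A Z x)) • B x := by
      rw [hn.cov_sub univ_mem ((SmoothNear.smul hVB hZ).add (.smul hZB hV)) (.smul hVZ hBs),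
        hn.cov_add univ_mem (SmoothNear.smul hVB hZ) (.smul hZB hV), hn.cov_smul univ_mem hVB hZ,
        hn.cov_smul univ_mem hZB hV, hn.cov_smul univ_mem hVZ hBs,
        hn.dir_metric univ_mem hV hBs, hn.dir_metric univ_mem hZ hBs, hn.dir_metric univ_mem hV hZ,
        hpar]
      simp
    have e2 : cov nabla A (cov nabla' V Z) x
        = cov nabla A (cov nabla V Z) x - (1 / 2 : ℝ) • cov nabla A T x := by
      rw [hn.cov_congr univ_mem hcov' (hcov.sub (hT.const_smul _)) ev,
        hn.cov_sub univ_mem hcov (hT.const_smul _), hn.cov_const_smul univ_mem _ hT]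
    have e3 := cov_conformal hn hn' hU hf.mdiffAt hB.self_of_nhds hA hcov'
    have e4 : cov nabla' V Z x = cov nabla V Z x - (1 / 2 : ℝ) • (g.inner x (V x) (B x) • Z x
      + g.inner x (Z x) (B x) • V x - g.inner x (V x) (Z x) • B x) := ev.self_of_nhds
    rw [e4, e2, e1] at e3
    exact e3
  -- Writing the bracket as `∇_X Y - ∇_Y X` lets all first derivatives of `X`, `Y`, `Z` in the
  -- correction cancel; what remains is algebraic, with `g(B,B) = 1` inserted.
  rw [curvature_eq_cov, curvature_eq_cov, twice hX hY, twice hY hX,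
    cov_conformal hn hn' hU hf.mdiffAt hB.self_of_nhds (hX.mlieBracket hY) hZ,
    ← hn.cov_sub_cov univ_mem hX hY]
  simp only [map_add, map_sub, map_smul, add_apply, sub_apply, smul_apply, smul_eq_mul, hB1,
    g.symm x (Y x) (X x), g.symm x (cov nabla X Y x) (Z x)]
  module

end Weyl

/-! ### Pointwise quaternionic linear algebra. -/

section QuaternionAlgebra

variable {V : Type*} [AddCommGroup V] [Module ℝ V] [TopologicalSpace V]
  {g : V →L[ℝ] V →L[ℝ] ℝ} {J : Fin 3 → V →L[ℝ] V}

/-- Three almost complex structures satisfying the quaternion relations, isometric for `g`. -/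
structure IsQuaternionTriple (g : V →L[ℝ] V →L[ℝ] ℝ) (J : Fin 3 → V →L[ℝ] V) : Prop where
  sq : ∀ a v, J a (J a v) = -v
  mul : ∀ v, J 0 (J 1 v) = J 2 v
  isometric : ∀ a v w, g (J a v) (J a w) = g v w
  symm : ∀ v w, g v w = g w v

namespace IsQuaternionTriple

variable (hJ : IsQuaternionTriple g J)
include hJ

lemma skew (a : Fin 3) (v w : V) : g (J a v) w = - g v (J a w) := by
  rw [← hJ.isometric a, hJ.sq]; simp

lemma inner_self (a : Fin 3) (v : V) : g (J a v) v = 0 := by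
  have h := hJ.skew a v v
  rw [hJ.symm v] at h
  linarith

lemma mul_zero_two (v : V) : J 0 (J 2 v) = - J 1 v := by
  rw [← hJ.mul, hJ.sq]

/-- Anticommutation is forced by `(J 0 J 1)² = (J 2)² = -1`, once the outer factors are stripped
with `(J a)² = -1`. -/
lemma mul_one_zero (v : V) : J 1 (J 0 v) = - J 2 v := by
  have h := hJ.sq 2 (J 1 v)
  rw [← hJ.mul, ← hJ.mul, hJ.sq 1] at h
  have h2 := congrArg (J 0) h
  rw [hJ.sq 0] at h2
  simp only [map_neg, neg_neg] at h2
  rw [h2, hJ.mul]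

lemma mul_two_zero (v : V) : J 2 (J 0 v) = J 1 v := by
  rw [← hJ.mul, hJ.mul_one_zero, map_neg, hJ.mul_zero_two, neg_neg]

lemma inner_zero_one (v : V) : g (J 0 v) (J 1 v) = 0 := by
  rw [hJ.skew, hJ.mul, hJ.symm, hJ.inner_self, neg_zero]

lemma inner_zero_two (v : V) : g (J 0 v) (J 2 v) = 0 := by
  rw [hJ.skew, hJ.mul_zero_two, map_neg, hJ.symm, hJ.inner_self]; simp

lemma mul_one_two (v : V) : J 1 (J 2 v) = J 0 v := by
  have h := hJ.mul_one_zero (J 1 v)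
  rw [hJ.mul] at h
  rw [h, ← hJ.mul, hJ.sq, map_neg, neg_neg]

lemma inner_one_two (v : V) : g (J 1 v) (J 2 v) = 0 := by
  rw [hJ.skew, hJ.mul_one_two, hJ.symm, hJ.inner_self, neg_zero]

lemma inner_apply (a b : Fin 3) (v : V) :
    g (J a v) (J b v) = if a = b then g v v else 0 := by
  have h1 := hJ.inner_zero_one v
  have h2 := hJ.inner_zero_two v
  have h3 := hJ.inner_one_two v
  have h1' := hJ.symm (J 1 v) (J 0 v)
  have h2' := hJ.symm (J 2 v) (J 0 v)
  have h3' := hJ.symm (J 2 v) (J 1 v)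
  fin_cases a <;> fin_cases b <;> simp_all [hJ.isometric]

/-- The three vectors `J a v` are pairwise orthogonal of the same length as `v`, so pairing recovers
coefficients. This is how the coefficients of `∇J` are seen to be smooth. -/
lemma inner_sum (k : Fin 3 → ℝ) (b : Fin 3) (v : V) :
    g (∑ a, k a • J a v) (J b v) = k b * g v v := by
  simp [hJ.inner_apply]

end IsQuaternionTriple

end QuaternionAlgebra

/-! ### Curvature of a connection preserving `H`. -/

section Commutator

variable {E : Type*} [NormedAddCommGroup E] [NormedSpace ℝ E]
  {N : Type*} [TopologicalSpace N] [ChartedSpace E N] [IsManifold 𝓘(ℝ, E) ∞ N]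
  {g : ContMDiffRiemannianMetric 𝓘(ℝ, E) ∞ E (fun x : N ↦ TangentSpace 𝓘(ℝ, E) x)}
  {g' : Π x : N, TangentSpace 𝓘(ℝ, E) x →L[ℝ] TangentSpace 𝓘(ℝ, E) x →L[ℝ] ℝ}
  {nabla : (Π x : N, TangentSpace 𝓘(ℝ, E) x) →
      (Π x : N, TangentSpace 𝓘(ℝ, E) x →L[ℝ] TangentSpace 𝓘(ℝ, E) x)}
  {H : Π x : N, Submodule ℝ (TangentSpace 𝓘(ℝ, E) x →L[ℝ] TangentSpace 𝓘(ℝ, E) x)}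
  {U : Set N} {X Y Z : Π x : N, TangentSpace 𝓘(ℝ, E) x} {x : N}
  {J : Fin 3 → Π y : N, TangentSpace 𝓘(ℝ, E) y →L[ℝ] TangentSpace 𝓘(ℝ, E) y}

/-- `J` is a frame of `H` near `x`, consisting of smooth almost complex structures that satisfy the
quaternion relations and are isometric for `g`. -/
structure IsQuaternionFrame
    (g : Π x : N, TangentSpace 𝓘(ℝ, E) x →L[ℝ] TangentSpace 𝓘(ℝ, E) x →L[ℝ] ℝ)
    (H : Π x : N, Submodule ℝ (TangentSpace 𝓘(ℝ, E) x →L[ℝ] TangentSpace 𝓘(ℝ, E) x))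
    (J : Fin 3 → Π y : N, TangentSpace 𝓘(ℝ, E) y →L[ℝ] TangentSpace 𝓘(ℝ, E) y) (x : N) :
    Prop where
  smooth : ∀ a, ∀ᶠ y in 𝓝 x, ContMDiffAt 𝓘(ℝ, E) (𝓘(ℝ, E).prod 𝓘(ℝ, E →L[ℝ] E)) ∞
        (fun y ↦ TotalSpace.mk' (E →L[ℝ] E)
          (E := fun y : N ↦ TangentSpace 𝓘(ℝ, E) y →L[ℝ] TangentSpace 𝓘(ℝ, E) y) y (J a y)) y
  triple : ∀ᶠ y in 𝓝 x, IsQuaternionTriple (g y) (fun a ↦ J a y)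
  span : ∀ᶠ y in 𝓝 x, H y = Submodule.span ℝ (Set.range fun a ↦ J a y)

lemma IsQuaternionHermitianOn.exists_frame (h : IsQuaternionHermitianOn g.inner H U) (hx : x ∈ U) :
    ∃ J, IsQuaternionFrame g.inner H J x := by
  obtain ⟨V, hV, hxV, J, hJ, hJ'⟩ := h x hx
  refine ⟨J, ⟨fun a ↦ ?_, ?_, ?_⟩⟩
  · filter_upwards [hV.mem_nhds hxV] with y hy using (hJ a).contMDiffAt (hV.mem_nhds hy)
  · filter_upwards [hV.mem_nhds hxV] with y hy
    exact ⟨(hJ' y hy).1, (hJ' y hy).2.1, (hJ' y hy).2.2.1, g.symm y⟩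
  · filter_upwards [hV.mem_nhds hxV] with y hy using (hJ' y hy).2.2.2

namespace IsQuaternionFrame

variable (hJ : IsQuaternionFrame g.inner H J x)
include hJ

lemma eventually : ∀ᶠ y in 𝓝 x, IsQuaternionFrame g.inner H J y := by
  filter_upwards [eventually_eventually_nhds.2 hJ.triple, eventually_eventually_nhds.2 hJ.span,
    eventually_all.2 fun a ↦ eventually_eventually_nhds.2 (hJ.smooth a)] with y h1 h2 h3
  exact ⟨h3, h1, h2⟩

lemma smoothNear (a : Fin 3) (hX : SmoothNear X x) : SmoothNear (fun y ↦ J a y (X y)) x :=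
  .clm (hJ.smooth a) hX

lemma mem (a : Fin 3) : J a x ∈ H x := by
  rw [hJ.span.self_of_nhds]
  exact Submodule.subset_span ⟨a, rfl⟩

/-- The derivative of the frame `J`, for a connection that preserves `H`. -/
lemma exists_cov_eq (hx : x ∈ U) (hp : PreservesOn nabla H U) (a : Fin 3)
    (X : Π x : N, TangentSpace 𝓘(ℝ, E) x) :
    ∃ k : Fin 3 → ℝ, ∀ Z : Π x : N, TangentSpace 𝓘(ℝ, E) x, SmoothNear Z x →
      cov nabla X (fun y ↦ J a y (Z y)) x - J a x (cov nabla X Z x)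
        = ∑ b, k b • J b x (Z x) := by
  obtain ⟨K, hK, h⟩ := hp x hx (J a) (hJ.smooth a).self_of_nhds
    (hJ.eventually.mono fun y hy ↦ hy.mem a) (X x)
  rw [hJ.span.self_of_nhds, Submodule.mem_span_range_iff_exists_fun] at hK
  obtain ⟨k, rfl⟩ := hK
  refine ⟨k, fun Z hZ ↦ ?_⟩
  refine (h Z hZ.mdiffAt).trans ?_
  simp

/-- The coefficients of the derivative of the frame `J` are smooth. -/
lemma exists_smooth_cov_eq (hn : IsLeviCivitaOn g' nabla U) (hU : U ∈ 𝓝 x)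
    (hp : PreservesOn nabla H U) (a : Fin 3) (hX : SmoothNear X x) :
    ∃ k : Fin 3 → N → ℝ, (∀ b, SmoothFunNear E (k b) x) ∧ ∀ᶠ y in 𝓝 x,
      ∀ Z : Π x : N, TangentSpace 𝓘(ℝ, E) x, SmoothNear Z y →
      cov nabla X (fun y ↦ J a y (Z y)) y - J a y (cov nabla X Z y)
        = ∑ b, k b y • J b y (Z y) := by
  rcases subsingleton_or_nontrivial E with hE | hE
  · refine ⟨fun _ _ ↦ 0, fun _ ↦ .const 0, Eventually.of_forall fun y Z _ ↦ ?_⟩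
    exact Subsingleton.elim (α := E) _ _
  obtain ⟨w, hw⟩ := exists_ne (0 : E)
  obtain ⟨W, hW, hWx⟩ := exists_smoothNear_eq (x := x) (show TangentSpace 𝓘(ℝ, E) x from w)
  have hφ := smoothFunNear_metric g hW hW
  have hφx : g.inner x (W x) (W x) ≠ 0 := (g.pos x _ (by rw [hWx]; exact hw)).ne'
  have hD : SmoothNear (cov nabla X (fun y ↦ J a y (W y)) - fun y ↦ J a y (cov nabla X W y)) x :=
    (hn.smoothNear_cov hU hX (hJ.smoothNear a hW)).sub
      (hJ.smoothNear a (hn.smoothNear_cov hU hX hW))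
  -- The coefficients are `g((∇_X J_a)W, J_b W) / g(W,W)` for one test field `W`, hence smooth. They
  -- serve every `Z`, because at each point `∇_X J_a` is a single endomorphism in `H`.
  refine ⟨fun b ↦ (fun y ↦ g.inner y (W y) (W y))⁻¹ * fun y ↦ g.inner y
    ((cov nabla X (fun y ↦ J a y (W y)) - fun y ↦ J a y (cov nabla X W y)) y) (J b y (W y)),
    fun b ↦ (hφ.inv hφx).mul (smoothFunNear_metric g hD (hJ.smoothNear b hW)), ?_⟩
  filter_upwards [hJ.eventually, eventually_mem_nhds_iff.2 hU, hW.eventually,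
    hφ.cmdiffAt.continuousAt.eventually_ne hφx] with y h1 h2 h3 h4 Z hZ
  obtain ⟨k, hk⟩ := h1.exists_cov_eq (mem_of_mem_nhds h2) hp a X
  rw [hk Z hZ]
  refine Finset.sum_congr rfl fun b _ ↦ ?_
  congr 1
  simp only [Pi.mul_apply, Pi.inv_apply, Pi.sub_apply]
  rw [hk W h3, h1.triple.self_of_nhds.inner_sum]
  field_simp

/-- The curvature of a connection that preserves `H` commutes with the sections of `H`, up to
sections of `H`. -/
lemma curvature_sub_mem [CompleteSpace E] (hn : IsLeviCivitaOn g' nabla U) (hU : U ∈ 𝓝 x)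
    (hp : PreservesOn nabla H U) (a : Fin 3) (hX : SmoothNear X x) (hY : SmoothNear Y x)
    (hZ : SmoothNear Z x) :
    curvature nabla X Y (fun y ↦ J a y (Z y)) x - J a x (curvature nabla X Y Z x)
      ∈ Submodule.span ℝ (Set.range fun b ↦ J b x (Z x)) := by
  set S : Submodule ℝ (TangentSpace 𝓘(ℝ, E) x) :=
    Submodule.span ℝ (Set.range fun b ↦ J b x (Z x)) with hS
  have memS (b) : J b x (Z x) ∈ S := Submodule.subset_span ⟨b, rfl⟩
  have sum_mem (k : Fin 3 → ℝ) : ∑ b, k b • J b x (Z x) ∈ S :=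
    Submodule.sum_mem _ fun b _ ↦ S.smul_mem _ (memS b)
  obtain ⟨k, hk, hkX⟩ := hJ.exists_smooth_cov_eq hn hU hp a hX
  obtain ⟨l, hl, hlY⟩ := hJ.exists_smooth_cov_eq hn hU hp a hY
  -- Modulo `S`, the second derivative of `J_a Z` is `J_a ∇_X ∇_Y Z` plus two sums that are
  -- exchanged when `(X,k)` and `(Y,l)` are; they disappear in the curvature.
  have twice {X Y} {k l : Fin 3 → N → ℝ} (hX : SmoothNear X x) (hY : SmoothNear Y x)
      (hl : ∀ b, SmoothFunNear E (l b) x)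
      (hkX : ∀ᶠ y in 𝓝 x,
        ∀ Z : Π x : N, TangentSpace 𝓘(ℝ, E) x, SmoothNear Z y →
        cov nabla X (fun y ↦ J a y (Z y)) y - J a y (cov nabla X Z y)
          = ∑ b, k b y • J b y (Z y))
      (hlY : ∀ᶠ y in 𝓝 x,
        ∀ Z : Π x : N, TangentSpace 𝓘(ℝ, E) x, SmoothNear Z y →
        cov nabla Y (fun y ↦ J a y (Z y)) y - J a y (cov nabla Y Z y)
          = ∑ b, l b y • J b y (Z y)) :
      cov nabla X (cov nabla Y (fun y ↦ J a y (Z y))) x - (J a x (cov nabla X (cov nabla Y Z) x)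
        + ∑ b, k b x • J b x (cov nabla Y Z x) + ∑ b, l b x • J b x (cov nabla X Z x)) ∈ S := by
    have hYZ := hn.smoothNear_cov hU hY hZ
    have hsm (b) := hJ.smoothNear b hZ
    have ev : cov nabla Y (fun y ↦ J a y (Z y)) =ᶠ[𝓝 x]
        (fun y ↦ J a y (cov nabla Y Z y)) + ∑ b, l b • fun y ↦ J b y (Z y) := by
      filter_upwards [hlY, hZ.eventually] with y h1 h2
      refine sub_eq_iff_eq_add'.1 ((h1 Z h2).trans ?_)
      rw [Finset.sum_apply]
      rfl
    have hsum : SmoothNear (∑ b, l b • fun y ↦ J b y (Z y)) x :=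
      SmoothNear.sum _ fun b ↦ .smul (hl b) (hsm b)
    have e1 : cov nabla X (fun y ↦ J a y (cov nabla Y Z y)) x
        = J a x (cov nabla X (cov nabla Y Z) x) + ∑ b, k b x • J b x (cov nabla Y Z x) :=
      sub_eq_iff_eq_add'.1 (hkX.self_of_nhds _ hYZ)
    have e2 : cov nabla X (cov nabla Y (fun y ↦ J a y (Z y))) x
        = J a x (cov nabla X (cov nabla Y Z) x) + ∑ b, k b x • J b x (cov nabla Y Z x)
          + ∑ b, (l b x • cov nabla X (fun y ↦ J b y (Z y)) x
            + dir X (l b) x • J b x (Z x)) := by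
      rw [hn.cov_congr hU (hn.smoothNear_cov hU hY (hsm a)) ((hJ.smoothNear a hYZ).add hsum) ev,
        hn.cov_add hU (hJ.smoothNear a hYZ) hsum, e1, hn.cov_sum hU _ fun b ↦ .smul (hl b) (hsm b)]
      congr 1
      exact Finset.sum_congr rfl fun b _ ↦ hn.cov_smul hU (hl b) (hsm b)
    rw [e2, add_sub_add_left_eq_sub, ← Finset.sum_sub_distrib]
    refine Submodule.sum_mem _ fun b _ ↦ ?_
    obtain ⟨m, hm⟩ := hJ.exists_cov_eq (mem_of_mem_nhds hU) hp b X
    have e3 := hm Z hZ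
    have e4 : l b x • cov nabla X (fun y ↦ J b y (Z y)) x + dir X (l b) x • J b x (Z x)
        - l b x • J b x (cov nabla X Z x) = l b x • (cov nabla X (fun y ↦ J b y (Z y)) x
          - J b x (cov nabla X Z x)) + dir X (l b) x • J b x (Z x) := by module
    rw [e4, e3]
    exact S.add_mem (S.smul_mem _ (sum_mem m)) (S.smul_mem _ (memS b))
  have h1 := twice hX hY hl hkX hlY
  have h2 := twice hY hX hk hlY hkX
  obtain ⟨m, hm⟩ := hJ.exists_cov_eq (mem_of_mem_nhds hU) hp a
    (VectorField.mlieBracket 𝓘(ℝ, E) X Y)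
  have h3 := sum_mem m
  rw [← hm Z hZ] at h3
  convert S.sub_mem (S.sub_mem h1 h2) h3 using 1
  simp only [curvature_eq_cov, map_sub]
  abel

end IsQuaternionFrame

end Commutator

/-! ### Immersed submanifolds and the umbilical Codazzi equation. -/

section Codazzi

variable {E : Type*} [NormedAddCommGroup E] [NormedSpace ℝ E]
  {N : Type*} [TopologicalSpace N] [ChartedSpace E N] [IsManifold 𝓘(ℝ, E) ∞ N]
  {F : Type*} [NormedAddCommGroup F] [NormedSpace ℝ F]
  {M : Type*} [TopologicalSpace M] [ChartedSpace F M] [IsManifold 𝓘(ℝ, F) ∞ M]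
  {g : ContMDiffRiemannianMetric 𝓘(ℝ, E) ∞ E (fun x : N ↦ TangentSpace 𝓘(ℝ, E) x)}
  {nabla : (Π x : N, TangentSpace 𝓘(ℝ, E) x) →
      (Π x : N, TangentSpace 𝓘(ℝ, E) x →L[ℝ] TangentSpace 𝓘(ℝ, E) x)}
  {i : M → N} {p : M} {X Y Z : Π x : N, TangentSpace 𝓘(ℝ, E) x}

/-- The tangent space of the immersed submanifold `i : M → N` at `p`. -/
def tangentRange (i : M → N) (p : M) : Submodule ℝ (TangentSpace 𝓘(ℝ, E) (i p)) :=
  LinearMap.range (mfderiv 𝓘(ℝ, F) 𝓘(ℝ, E) i p).toLinearMap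

lemma mem_tangentRange {v : TangentSpace 𝓘(ℝ, E) (i p)} : v ∈ tangentRange (F := F) i p ↔
    ∃ w : TangentSpace 𝓘(ℝ, F) p, mfderiv 𝓘(ℝ, F) 𝓘(ℝ, E) i p w = v := Iff.rfl

variable (F) in
/-- The vector field `X` is tangent to the immersed submanifold `i : M → N` near `p`. -/
def TangentAlong (i : M → N) (X : Π x : N, TangentSpace 𝓘(ℝ, E) x) (p : M) : Prop :=
  ∀ᶠ q in 𝓝 p, X (i q) ∈ tangentRange (F := F) i q

lemma TangentAlong.sub (hX : TangentAlong F i X p) (hY : TangentAlong F i Y p) :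
    TangentAlong F i (X - Y) p := by
  filter_upwards [hX, hY] with q h1 h2 using Submodule.sub_mem _ h1 h2

lemma TangentAlong.smul (f : N → ℝ) (hX : TangentAlong F i X p) :
    TangentAlong F i (f • X) p := by
  filter_upwards [hX] with q h1 using Submodule.smul_mem _ _ h1

lemma mdifferentiable_of_mem_maximalAtlas {e : OpenPartialHomeomorph N E}
    (he : e ∈ IsManifold.maximalAtlas 𝓘(ℝ, E) ∞ N) : e.MDifferentiable 𝓘(ℝ, E) 𝓘(ℝ, E) :=
  ⟨(contMDiffOn_of_mem_maximalAtlas he).mdifferentiableOn (by simp),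
    (contMDiffOn_symm_of_mem_maximalAtlas he).mdifferentiableOn (by simp)⟩

/-- In the charts of an immersion `i` is the linear inclusion of `F` into `F × C ≃ E`. Both the
injectivity of `di` and the extension of tangent vectors rest on this. -/
lemma mfderiv_codChart_mfderiv {C : Type*} [NormedAddCommGroup C] [NormedSpace ℝ C]
    (h : Manifold.IsImmersionAtOfComplement C 𝓘(ℝ, F) 𝓘(ℝ, E) ∞ i p) {q : M}
    (hq : q ∈ h.domChart.source) (hdiff : MDifferentiableAt 𝓘(ℝ, F) 𝓘(ℝ, E) i q)
    (w : TangentSpace 𝓘(ℝ, F) q) :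
    mfderiv 𝓘(ℝ, E) 𝓘(ℝ, E) h.codChart (i q) (mfderiv 𝓘(ℝ, F) 𝓘(ℝ, E) i q w)
      = h.equiv (mfderiv 𝓘(ℝ, F) 𝓘(ℝ, F) h.domChart q w, 0) := by
  have hφ := mdifferentiable_of_mem_maximalAtlas h.domChart_mem_maximalAtlas
  have hψ := mdifferentiable_of_mem_maximalAtlas h.codChart_mem_maximalAtlas
  let L : F →L[ℝ] E := h.equiv.toContinuousLinearMap.comp (ContinuousLinearMap.inl ℝ F C)
  have ev : h.codChart ∘ i =ᶠ[𝓝 q] L ∘ h.domChart := by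
    filter_upwards [h.domChart.open_source.mem_nhds hq] with q' hq'
    have hm : h.domChart.extend 𝓘(ℝ, F) q' ∈ (h.domChart.extend 𝓘(ℝ, F)).target := by
      simpa using h.domChart.map_source hq'
    have := h.writtenInCharts hm
    simpa [L, h.domChart.left_inv hq'] using this
  have h1 := ev.mfderiv_eq (I := 𝓘(ℝ, F)) (I' := 𝓘(ℝ, E))
  rw [mfderiv_comp q (hψ.mdifferentiableAt (h.mapsto_domChart_source_codChart_source hq)) hdiff,
    mfderiv_comp q L.mdifferentiableAt (hφ.mdifferentiableAt hq), L.mfderiv_eq] at h1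
  exact congrArg (fun A ↦ A w) h1

/-- The derivative of an immersion is injective. -/
lemma mfderiv_ne_zero_of_isImmersion (hi : Manifold.IsImmersion 𝓘(ℝ, F) 𝓘(ℝ, E) ∞ i)
    {w : TangentSpace 𝓘(ℝ, F) p} (hw : w ≠ 0) : mfderiv 𝓘(ℝ, F) 𝓘(ℝ, E) i p w ≠ 0 := by
  obtain ⟨C, _, _, h⟩ := hi.isImmersionAt p
  have hφ := mdifferentiable_of_mem_maximalAtlas h.domChart_mem_maximalAtlas
  intro h0
  have h1 := mfderiv_codChart_mfderiv h h.mem_domChart_source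
    (hi.contMDiff.mdifferentiable (by simp) p) w
  rw [h0, map_zero] at h1
  have h2 := h.equiv.map_eq_zero_iff.1 h1.symm
  exact hw ((hφ.mfderiv h.mem_domChart_source).map_eq_zero_iff.1 (Prod.ext_iff.1 h2).1)

/-- A tangent vector of an immersed submanifold extends to a smooth vector field of the ambient
manifold which is tangent to the submanifold. -/
lemma exists_tangentAlong [CompleteSpace E] (hi : Manifold.IsImmersion 𝓘(ℝ, F) 𝓘(ℝ, E) ∞ i)
    {v : TangentSpace 𝓘(ℝ, E) (i p)} (hv : v ∈ tangentRange (F := F) i p) :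
    ∃ X : Π x : N, TangentSpace 𝓘(ℝ, E) x,
      SmoothNear X (i p) ∧ X (i p) = v ∧ TangentAlong F i X p := by
  obtain ⟨u, rfl⟩ := mem_tangentRange.1 hv
  obtain ⟨C, _, _, h⟩ := hi.isImmersionAt p
  have hφ := mdifferentiable_of_mem_maximalAtlas h.domChart_mem_maximalAtlas
  have hψ := mdifferentiable_of_mem_maximalAtlas h.codChart_mem_maximalAtlas
  have hdiff : MDifferentiable 𝓘(ℝ, F) 𝓘(ℝ, E) i := hi.contMDiff.mdifferentiable (by simp)
  -- The extension is the field that is constant in the codomain chart; its constant value lies in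
  -- the factor `F`, so it is tangent along the submanifold.
  let u' : F := mfderiv 𝓘(ℝ, F) 𝓘(ℝ, F) h.domChart p u
  let X : Π x : N, TangentSpace 𝓘(ℝ, E) x :=
    VectorField.mpullback 𝓘(ℝ, E) 𝓘(ℝ, E) h.codChart (fun _ ↦ (h.equiv (u', 0) : E))
  have hinv {y : N} (hy : y ∈ h.codChart.source) :
      (mfderiv 𝓘(ℝ, E) 𝓘(ℝ, E) h.codChart y).IsInvertible := ⟨hψ.mfderiv hy, rfl⟩
  have val {q : M} (hq : q ∈ h.domChart.source) (w : TangentSpace 𝓘(ℝ, F) q)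
      (hw : mfderiv 𝓘(ℝ, F) 𝓘(ℝ, F) h.domChart q w = u') :
      mfderiv 𝓘(ℝ, F) 𝓘(ℝ, E) i q w = X (i q) := by
    have h1 := mfderiv_codChart_mfderiv h hq (hdiff q) w
    rw [hw] at h1
    exact ((hinv (h.mapsto_domChart_source_codChart_source hq)).inverse_apply_eq.2 h1.symm).symm
  refine ⟨X, ?_, (val h.mem_domChart_source u rfl).symm, ?_⟩
  · filter_upwards [h.codChart.open_source.mem_nhds h.mem_codChart_source] with y hy
    refine ContMDiffAt.mpullback_vectorField_preimage (n := ∞) ?_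
      (contMDiffAt_of_mem_maximalAtlas h.codChart_mem_maximalAtlas hy) (hinv hy) (by simp)
    exact contMDiffAt_vectorSpace_iff_contDiffAt.2 contDiffAt_const
  · filter_upwards [h.domChart.open_source.mem_nhds h.mem_domChart_source] with q hq
    refine ⟨(hφ.mfderiv hq).symm u', val hq _ ?_⟩
    exact (hφ.mfderiv hq).apply_symm_apply u'

/-- The curvature tensor `R(X,Y)Z` of the ambient space along a totally umbilical submanifold is
tangent to the submanifold if `X`, `Y`, `Z` are, and `Z` is orthogonal to `X` and `Y`. -/
lemma curvature_mem_tangentRange_of_orthogonal (hn : IsLeviCivitaOn g.inner nabla univ)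
    (hi : Manifold.IsImmersion 𝓘(ℝ, F) 𝓘(ℝ, E) ∞ i)
    (humb : IsTotallyUmbilical (F := F) g.inner nabla i)
    (hX : SmoothNear X (i p)) (hY : SmoothNear Y (i p)) (hZ : SmoothNear Z (i p))
    (hXt : TangentAlong F i X p) (hYt : TangentAlong F i Y p) (hZt : TangentAlong F i Z p)
    (hXZ : ∀ᶠ y in 𝓝 (i p), g.inner y (X y) (Z y) = 0)
    (hYZ : ∀ᶠ y in 𝓝 (i p), g.inner y (Y y) (Z y) = 0) :
    curvature nabla X Y Z (i p) ∈ tangentRange (F := F) i p := by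
  obtain ⟨h, hh, η, hη⟩ := humb
  have hic : Continuous i := hi.contMDiff.continuous
  have gauss {q : M} {V : Π x : N, TangentSpace 𝓘(ℝ, E) x} {a : TangentSpace 𝓘(ℝ, E) (i q)}
      (hV : SmoothNear V (i q)) (hVt : TangentAlong F i V q)
      (ha : a ∈ tangentRange (F := F) i q) :
      nabla V (i q) a - g.inner (i q) a (V (i q)) • η q ∈ tangentRange (F := F) i q := by
    obtain ⟨u, rfl⟩ := mem_tangentRange.1 ha
    obtain ⟨v, hv⟩ := mem_tangentRange.1 hVt.self_of_nhds
    obtain ⟨w, hw⟩ := hh.gauss q u v V hV.cmdiffAt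
      (hVt.mono fun q' ⟨w, hw⟩ ↦ ⟨w, hw.symm⟩) hv.symm
    refine ⟨w, ?_⟩
    rw [hw, hη, hv, add_sub_cancel_right]
    rfl
  have tang {A : Π x : N, TangentSpace 𝓘(ℝ, E) x} (hAt : TangentAlong F i A p)
      (hAZ : ∀ᶠ y in 𝓝 (i p), g.inner y (A y) (Z y) = 0) :
      TangentAlong F i (cov nabla A Z) p := by
    filter_upwards [hAt, hZt.eventually_nhds, hic.continuousAt.eventually hAZ,
      hic.continuousAt.eventually hZ.eventually] with q h1 h2 h3 h4
    have := gauss h4 h2 h1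
    rwa [h3, zero_smul, sub_zero] at this
  have hbr : VectorField.mlieBracket 𝓘(ℝ, E) X Y (i p) ∈ tangentRange (F := F) i p := by
    have h1 := gauss hY hYt hXt.self_of_nhds
    have h2 := gauss hX hXt hYt.self_of_nhds
    rw [g.symm] at h2
    have h3 := Submodule.sub_mem _ h1 h2
    rw [sub_sub_sub_cancel_right] at h3
    rwa [← hn.cov_sub_cov univ_mem hX hY]
  -- This differentiates `g(V,Z) = 0`. It turns the normal parts of the three terms of `R(X,Y)Z`
  -- into multiples of `η` with `g(∇_X Y,Z)` and `g(∇_Y X,Z)` as coefficients, which cancel. Since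
  -- `∇_X Z` and `∇_Y Z` are themselves tangent, `η` is never differentiated.
  have zero (A : Π x : N, TangentSpace 𝓘(ℝ, E) x) {V : Π x : N, TangentSpace 𝓘(ℝ, E) x}
      (hV : SmoothNear V (i p)) (hVZ : ∀ᶠ y in 𝓝 (i p), g.inner y (V y) (Z y) = 0) :
      g.inner (i p) (V (i p)) (cov nabla A Z (i p))
        = - g.inner (i p) (cov nabla A V (i p)) (Z (i p)) := by
    have h1 := hn.dir_metric univ_mem (X := A) hV hZ
    rw [dir_congr (h := fun _ ↦ 0) hVZ] at h1
    simp only [dir, mvfderiv_const] at h1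
    have h2 : (0 : TangentSpace 𝓘(ℝ, E) (i p) →L[ℝ] ℝ) (A (i p)) = 0 := rfl
    linarith
  have h1 := gauss (hn.smoothNear_cov univ_mem hY hZ) (tang hYt hYZ) hXt.self_of_nhds
  have h2 := gauss (hn.smoothNear_cov univ_mem hX hZ) (tang hXt hXZ) hYt.self_of_nhds
  have h3 := gauss hZ hZt hbr
  rw [zero Y hX hXZ] at h1
  rw [zero X hY hYZ] at h2
  rw [← hn.cov_sub_cov univ_mem hX hY] at h3
  convert Submodule.sub_mem _ (Submodule.sub_mem _ h1 h2) h3 using 1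
  rw [curvature_eq_cov]
  simp only [cov, map_sub, sub_apply, ← hn.cov_sub_cov univ_mem hX hY]
  module

/-- The Codazzi equation of a totally umbilical submanifold, for tangent vectors `u`, `v`, `w`
with `w` orthogonal to `u` and `v`. -/
lemma curvature_mem_tangentRange [FiniteDimensional ℝ E] (hn : IsLeviCivitaOn g.inner nabla univ)
    (hi : Manifold.IsImmersion 𝓘(ℝ, F) 𝓘(ℝ, E) ∞ i)
    (humb : IsTotallyUmbilical (F := F) g.inner nabla i)
    (hX : SmoothNear X (i p)) (hY : SmoothNear Y (i p)) (hZ : SmoothNear Z (i p))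
    (hXt : X (i p) ∈ tangentRange (F := F) i p) (hYt : Y (i p) ∈ tangentRange (F := F) i p)
    (hZt : Z (i p) ∈ tangentRange (F := F) i p)
    (hXZ : g.inner (i p) (X (i p)) (Z (i p)) = 0) (hYZ : g.inner (i p) (Y (i p)) (Z (i p)) = 0)
    (hZ0 : Z (i p) ≠ 0) :
    curvature nabla X Y Z (i p) ∈ tangentRange (F := F) i p := by
  have := FiniteDimensional.complete ℝ E
  obtain ⟨W, hW, hWx, hWt⟩ := exists_tangentAlong hi hZt
  have hφ := smoothFunNear_metric g hW hW
  have hφx : g.inner (i p) (W (i p)) (W (i p)) ≠ 0 := by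
    rw [hWx]; exact (g.pos _ _ hZ0).ne'
  -- Orthogonality at one point is upgraded to orthogonality on a neighbourhood by a Gram-Schmidt
  -- step against `W`; tensoriality of the curvature then allows the exchange of fields.
  have adapt {A : Π x : N, TangentSpace 𝓘(ℝ, E) x} (hAt : A (i p) ∈ tangentRange (F := F) i p)
      (hAZ : g.inner (i p) (A (i p)) (Z (i p)) = 0) :
      ∃ A' : Π x : N, TangentSpace 𝓘(ℝ, E) x, SmoothNear A' (i p) ∧ A' (i p) = A (i p) ∧
        TangentAlong F i A' p ∧ ∀ᶠ y in 𝓝 (i p), g.inner y (A' y) (W y) = 0 := by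
    obtain ⟨V, hV, hVx, hVt⟩ := exists_tangentAlong hi hAt
    refine ⟨V - ((fun y ↦ g.inner y (V y) (W y)) * (fun y ↦ g.inner y (W y) (W y))⁻¹) • W,
      hV.sub (.smul ((smoothFunNear_metric g hV hW).mul (hφ.inv hφx)) hW), ?_,
      hVt.sub (hWt.smul _), ?_⟩
    · simp [hVx, hWx, hAZ]
    · filter_upwards [hφ.cmdiffAt.continuousAt.eventually_ne hφx] with y hy
      simp
      field_simp
      simp
  obtain ⟨X', hX', eX, tX, oX⟩ := adapt hXt hXZ
  obtain ⟨Y', hY', eY, tY, oY⟩ := adapt hYt hYZ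
  rw [hn.curvature_congr univ_mem hX hY hZ hX' hY' hW eX.symm eY.symm hWx.symm]
  exact curvature_mem_tangentRange_of_orthogonal hn hi humb hX' hY' hW tX tY hWt oX oY

end Codazzi

/-! ### Sectional curvature formula and the proper case. -/

section Main

variable {E : Type*} [NormedAddCommGroup E] [NormedSpace ℝ E]
  {N : Type*} [TopologicalSpace N] [ChartedSpace E N] [IsManifold 𝓘(ℝ, E) ∞ N]
  {F : Type*} [NormedAddCommGroup F] [NormedSpace ℝ F]
  {M : Type*} [TopologicalSpace M] [ChartedSpace F M] [IsManifold 𝓘(ℝ, F) ∞ M]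
  {g : ContMDiffRiemannianMetric 𝓘(ℝ, E) ∞ E (fun x : N ↦ TangentSpace 𝓘(ℝ, E) x)}
  {H : Π x : N, Submodule ℝ (TangentSpace 𝓘(ℝ, E) x →L[ℝ] TangentSpace 𝓘(ℝ, E) x)}
  {θ : Π x : N, TangentSpace 𝓘(ℝ, E) x →L[ℝ] ℝ}
  {B : Π x : N, TangentSpace 𝓘(ℝ, E) x}
  {nabla : (Π x : N, TangentSpace 𝓘(ℝ, E) x) →
      (Π x : N, TangentSpace 𝓘(ℝ, E) x →L[ℝ] TangentSpace 𝓘(ℝ, E) x)}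
  {i : M → N} {p : M} {x : N}
  {D D' : Π p : M, Submodule ℝ (TangentSpace 𝓘(ℝ, F) p)}

/-- The locally conformal quaternion Kaehler structure near a point, in terms of the Lee field. -/
lemma IsLCQK.exists_local (hN : IsLCQK g.inner H θ)
    (hB : ∀ (x : N) (v : TangentSpace 𝓘(ℝ, E) x), θ x v = g.inner x v (B x)) (x : N) :
    ∃ (U : Set N) (f : N → ℝ) (nabla' : (Π x : N, TangentSpace 𝓘(ℝ, E) x) →
      (Π x : N, TangentSpace 𝓘(ℝ, E) x →L[ℝ] TangentSpace 𝓘(ℝ, E) x)), U ∈ 𝓝 x ∧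
      SmoothFunNear E f x ∧ (∀ᶠ y in 𝓝 x, ∀ v, d% f y v = g.inner y v (B y)) ∧
      IsLeviCivitaOn (fun y ↦ Real.exp (-f y) • g.inner y) nabla' U ∧
      PreservesOn nabla' H U := by
  obtain ⟨U, hU, hxU, f, hf, ⟨-, nabla', hn', hp⟩, hθ⟩ := hN.locallyConformal x
  refine ⟨U, f, nabla', hU.mem_nhds hxU, ?_, ?_, hn', hp⟩
  · filter_upwards [hU.mem_nhds hxU] with y hy using hf.contMDiffAt (hU.mem_nhds hy)
  · filter_upwards [hU.mem_nhds hxU] with y hy v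
    rw [← hθ y hy, hB]

/-- The sectional curvature of the planes spanned by a vector of `D` and one of `D'`. -/
lemma sectionalCurvature_eq [FiniteDimensional ℝ E] (hN : IsLCQK g.inner H θ)
    (hB : ∀ (x : N) (v : TangentSpace 𝓘(ℝ, E) x), θ x v = g.inner x v (B x))
    (hn : IsLeviCivitaOn g.inner nabla univ) (hparallel : IsParallelForm nabla θ)
    (hunit : ∀ x : N, g.inner x (B x) (B x) = 1)
    (hi : Manifold.IsImmersion 𝓘(ℝ, F) 𝓘(ℝ, E) ∞ i)
    (hM : IsQuaternionCR g.inner H i D D')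
    (humb : IsTotallyUmbilical (F := F) g.inner nabla i)
    (htan : B (i p) ∈ tangentRange (F := F) i p)
    {X₀ Y₀ : TangentSpace 𝓘(ℝ, F) p} (hX₀ : X₀ ∈ D p) (hY₀ : Y₀ ∈ D' p)
    (h : IsOrthonormalPair g.inner i p X₀ Y₀) :
    sectionalCurvature g.inner nabla (i p) (mfderiv 𝓘(ℝ, F) 𝓘(ℝ, E) i p X₀)
      (mfderiv 𝓘(ℝ, F) 𝓘(ℝ, E) i p Y₀)
      = 1 / 4 * (1 - g.inner (i p) (mfderiv 𝓘(ℝ, F) 𝓘(ℝ, E) i p X₀) (B (i p)) ^ 2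
        - g.inner (i p) (mfderiv 𝓘(ℝ, F) 𝓘(ℝ, E) i p Y₀) (B (i p)) ^ 2) := by
  have := FiniteDimensional.complete ℝ E
  obtain ⟨U, f, nabla', hU, hf, hdf, hn', hp⟩ := hN.exists_local hB (i p)
  obtain ⟨J, hJ⟩ := hN.quaternionHermitian.exists_frame (mem_univ (i p))
  have hT := hJ.triple.self_of_nhds
  have hB0 : B (i p) ≠ 0 := by
    intro h0
    have := hunit (i p)
    rw [h0] at this
    simp at this
  have hBs := smoothNear_of_conformal hn hn' hU hf hdf hB0
  have hBp (X : Π x : N, TangentSpace 𝓘(ℝ, E) x) : cov nabla X B (i p) = 0 :=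
    cov_eq_zero_of_parallel hn hparallel hB hBs
  obtain ⟨huu, hvv, huv⟩ := h
  set u := mfderiv 𝓘(ℝ, F) 𝓘(ℝ, E) i p X₀ with hu
  set v := mfderiv 𝓘(ℝ, F) 𝓘(ℝ, E) i p Y₀ with hv
  set X : Π x : N, TangentSpace 𝓘(ℝ, E) x := FiberBundle.extend E u with hXdef
  set Y : Π x : N, TangentSpace 𝓘(ℝ, E) x := FiberBundle.extend E v with hYdef
  have hX : SmoothNear X (i p) := smoothNear_extend u
  have hY : SmoothNear Y (i p) := smoothNear_extend v
  have eX : X (i p) = u := FiberBundle.extend_apply_self ..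
  have eY : Y (i p) = v := FiberBundle.extend_apply_self ..
  have hJX := hJ.smoothNear 0 hX
  have hut : u ∈ tangentRange (F := F) i p := ⟨X₀, rfl⟩
  have hvt : v ∈ tangentRange (F := F) i p := ⟨Y₀, rfl⟩
  have hJt (b) : J b (i p) u ∈ tangentRange (F := F) i p := by
    obtain ⟨w, -, hw⟩ := hM.invariant p (J b (i p)) (hJ.mem b) X₀ hX₀
    exact ⟨w, hw.symm⟩
  have hJt0 := hJt 0
  have hJv {t} (ht : t ∈ tangentRange (F := F) i p) : g.inner (i p) (J 0 (i p) v) t = 0 := by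
    obtain ⟨w, rfl⟩ := mem_tangentRange.1 ht
    exact hM.totallyReal p _ (hJ.mem 0) Y₀ hY₀ w
  have huJu : g.inner (i p) u (J 0 (i p) u) = 0 := by
    rw [g.symm]; exact hT.inner_self 0 u
  have hvJu : g.inner (i p) v (J 0 (i p) u) = 0 := by
    obtain ⟨w, hwD, hw⟩ := hM.invariant p (J 0 (i p)) (hJ.mem 0) X₀ hX₀
    rw [hw, g.symm]
    exact hM.orthogonal p w hwD Y₀ hY₀
  have hJu0 : J 0 (i p) u ≠ 0 := by
    intro h0
    have := hT.isometric 0 u u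
    rw [h0, huu] at this
    simp at this
  -- Codazzi is applied to `JX` rather than `X`, because the third argument has to be orthogonal to
  -- both others.
  have cod : curvature nabla X Y (fun y ↦ J 0 y (X y)) (i p) ∈ tangentRange (F := F) i p := by
    refine curvature_mem_tangentRange hn hi humb hX hY hJX ?_ ?_ ?_ ?_ ?_ ?_
    all_goals simp only [eX, eY]
    all_goals assumption
  -- The tangency of `B` enters here: the conformal correction is a combination of `u`, `v` and `B`.
  have cod' : curvature nabla' X Y (fun y ↦ J 0 y (X y)) (i p) ∈ tangentRange (F := F) i p := by
    rw [curvature_conformal hn hn' hU hf hdf hBs (hunit _) hBp hX hY hJX]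
    simp only [eX, eY]
    refine Submodule.add_mem _ cod (Submodule.smul_mem _ _ ?_)
    refine Submodule.add_mem _ (Submodule.sub_mem _ (Submodule.add_mem _ (Submodule.sub_mem _
      (Submodule.sub_mem _ ?_ ?_) ?_) ?_) ?_) ?_
    all_goals exact Submodule.smul_mem _ _ (by assumption)
  have comm := hJ.curvature_sub_mem hn' hU hp 0 hX hY hX
  have hspan : Submodule.span ℝ (Set.range fun b ↦ J b (i p) (X (i p)))
      ≤ tangentRange (F := F) i p := by
    rw [Submodule.span_le]
    rintro _ ⟨b, rfl⟩
    change J b (i p) (X (i p)) ∈ tangentRange (F := F) i p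
    rw [eX]
    exact hJt b
  have hJR : J 0 (i p) (curvature nabla' X Y X (i p)) ∈ tangentRange (F := F) i p := by
    have := Submodule.sub_mem _ cod' (hspan comm)
    rwa [sub_sub_cancel] at this
  -- A tangent vector against the normal vector `Jv`; by isometry of `J` this is `g(v, R'(u,v)u) =
  -- 0`.
  have h1 := hJv hJR
  rw [hT.isometric 0, curvature_conformal hn hn' hU hf hdf hBs (hunit _) hBp hX hY hX] at h1
  have h2 := curvature_skew hn hX hY hX hY
  simp only [eX, eY, map_add, map_sub, map_smul, smul_eq_mul, huu, hvv, g.symm _ v u, huv] at h1 h2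
  simp only [sectionalCurvature, ← hXdef, ← hYdef, huu, hvv, huv]
  rw [g.symm _ (curvature nabla X Y Y (i p))]
  rw [g.symm _ _ v] at h2
  linarith

/-- A nonzero tangent vector orthogonal to the quaternionic line spanned by `B`. -/
lemma exists_orthogonal_quaternionic_line (hM : IsQuaternionCR g.inner H i D D')
    (hi : Manifold.IsImmersion 𝓘(ℝ, F) 𝓘(ℝ, E) ∞ i)
    {J : Fin 3 → Π y : N, TangentSpace 𝓘(ℝ, E) y →L[ℝ] TangentSpace 𝓘(ℝ, E) y}
    (hJ : IsQuaternionFrame g.inner H J (i p)) (hD : D p ≠ ⊥) (hD' : D' p ≠ ⊥)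
    {b : TangentSpace 𝓘(ℝ, E) (i p)} (hb : b ∈ tangentRange (F := F) i p) :
    ∃ w : TangentSpace 𝓘(ℝ, E) (i p), w ≠ 0 ∧ g.inner (i p) w b = 0 ∧
      ∀ a, g.inner (i p) w (J a (i p) b) = 0 := by
  have hT := hJ.triple.self_of_nhds
  obtain ⟨B₀, rfl⟩ := mem_tangentRange.1 hb
  obtain ⟨X, hX, Y, hY, rfl⟩ := Submodule.mem_sup.1
    ((hM.complementary p).sup_eq_top ▸ Submodule.mem_top : B₀ ∈ D p ⊔ D' p)
  have o1 {X Y} (hX : X ∈ D p) (hY : Y ∈ D' p) := hM.orthogonal p X hX Y hY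
  have o2 (a) {Y} (hY : Y ∈ D' p) (w) : g.inner (i p) (mfderiv 𝓘(ℝ, F) 𝓘(ℝ, E) i p w)
      (J a (i p) (mfderiv 𝓘(ℝ, F) 𝓘(ℝ, E) i p Y)) = 0 := by
    rw [g.symm]; exact hM.totallyReal p _ (hJ.mem a) Y hY w
  have o3 (a) {X Y} (hX : X ∈ D p) (hY : Y ∈ D' p) :
      g.inner (i p) (mfderiv 𝓘(ℝ, F) 𝓘(ℝ, E) i p Y)
        (J a (i p) (mfderiv 𝓘(ℝ, F) 𝓘(ℝ, E) i p X)) = 0 := by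
    obtain ⟨w, hw, e⟩ := hM.invariant p _ (hJ.mem a) X hX
    rw [e, g.symm]
    exact o1 hw hY
  by_cases hX0 : X = 0
  · obtain ⟨W, hW, hW0⟩ := (Submodule.ne_bot_iff _).1 hD
    refine ⟨_, mfderiv_ne_zero_of_isImmersion hi hW0, ?_, fun a ↦ ?_⟩
    · rw [hX0, zero_add, o1 hW hY]
    · rw [hX0, zero_add, o2 a hY]
  by_cases hY0 : Y = 0
  · obtain ⟨W, hW, hW0⟩ := (Submodule.ne_bot_iff _).1 hD'
    refine ⟨_, mfderiv_ne_zero_of_isImmersion hi hW0, ?_, fun a ↦ ?_⟩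
    · rw [hY0, add_zero, g.symm, o1 hX hW]
    · rw [hY0, add_zero, o3 a hX hW]
  have e1 := o1 hX hY
  have e2 (a) := o2 a hY X
  have e2' (a) := o2 a hY Y
  have e3 (a) := o3 a hX hY
  have e4 (a) := hT.inner_self a (mfderiv 𝓘(ℝ, F) 𝓘(ℝ, E) i p X)
  have pX := g.pos (i p) _ (mfderiv_ne_zero_of_isImmersion hi hX0)
  have pY := g.pos (i p) _ (mfderiv_ne_zero_of_isImmersion hi hY0)
  simp only [map_add]
  set u := mfderiv 𝓘(ℝ, F) 𝓘(ℝ, E) i p X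
  set v := mfderiv 𝓘(ℝ, F) 𝓘(ℝ, E) i p Y
  -- Both components of `b = u + v` are nonzero, and `w` is the combination of them orthogonal to
  -- `b`. It is orthogonal to each `J a b` because `J a u ∈ D` is orthogonal to `u` and `v`, and `J
  -- a v` is normal.
  refine ⟨g.inner (i p) v v • u - g.inner (i p) u u • v, ?_, ?_, fun a ↦ ?_⟩
  · intro h0
    have := congrArg (fun t ↦ g.inner (i p) t u) h0
    simp [g.symm _ v u, e1, pX.ne', pY.ne'] at this
  · simp [g.symm _ v u, e1, mul_comm]
  · simp [e2 a, e2' a, e3 a, g.symm _ u (J a (i p) u), e4 a]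

/-- If a proper quaternion CR-submanifold is tangent to the Lee field and the Lee form does not
vanish, the metric is not quaternion Kaehler. -/
lemma not_isQuaternionKaehlerOn (hN : IsLCQK g.inner H θ)
    (hB : ∀ (x : N) (v : TangentSpace 𝓘(ℝ, E) x), θ x v = g.inner x v (B x))
    (hn : IsLeviCivitaOn g.inner nabla univ)
    (hi : Manifold.IsImmersion 𝓘(ℝ, F) 𝓘(ℝ, E) ∞ i)
    (hM : IsQuaternionCR g.inner H i D D') (hD : D p ≠ ⊥) (hD' : D' p ≠ ⊥)
    (htan : B (i p) ∈ tangentRange (F := F) i p) (hB0 : B (i p) ≠ 0) :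
    ¬ IsQuaternionKaehlerOn g.inner H univ := by
  rintro ⟨-, nabla₂, hn₂, hp₂⟩
  obtain ⟨U, f, nabla', hU, hf, hdf, hn', hp⟩ := hN.exists_local hB (i p)
  obtain ⟨J, hJ⟩ := hN.quaternionHermitian.exists_frame (mem_univ (i p))
  have hT := hJ.triple.self_of_nhds
  obtain ⟨w, hw0, hwB, hwJ⟩ := exists_orthogonal_quaternionic_line hM hi hJ hD hD' htan
  obtain ⟨W, hW, rfl⟩ := exists_smoothNear_eq w
  have hJW := hJ.smoothNear 0 hW
  have hn₂' : IsLeviCivitaOn (fun y ↦ Real.exp (-(0 : ℝ)) • g.inner y) nabla₂ univ := by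
    simpa using hn₂
  -- Uniqueness of the Levi-Civita connection, as the conformal formula with `f = 0`.
  have same {Y : Π x : N, TangentSpace 𝓘(ℝ, E) x} (hY : SmoothNear Y (i p)) :
      cov nabla₂ W Y (i p) = cov nabla W Y (i p) := by
    have := cov_conformal (f := fun _ ↦ 0) (b := 0) hn hn₂' univ_mem mdifferentiableAt_const
      (fun v ↦ by rw [mvfderiv_const]; simp) hW hY
    simpa using this
  obtain ⟨k, hk⟩ := hJ.exists_cov_eq (mem_univ (i p)) hp₂ 0 W
  obtain ⟨l, hl⟩ := hJ.exists_cov_eq (mem_of_mem_nhds hU) hp 0 W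
  have hk := hk W hW
  have hl := hl W hW
  rw [same hW, same hJW] at hk
  rw [cov_conformal hn hn' hU hf.mdiffAt hdf.self_of_nhds hW hW,
    cov_conformal hn hn' hU hf.mdiffAt hdf.self_of_nhds hW hJW] at hl
  have h1 : g.inner (i p) (J 0 (i p) (W (i p))) (B (i p)) = 0 := by
    rw [hT.skew, hwJ, neg_zero]
  have h2 : g.inner (i p) (W (i p)) (J 0 (i p) (W (i p))) = 0 := by
    rw [g.symm]; exact hT.inner_self 0 _
  -- Difference of `(∇_W J)W` for the two connections: with `W` orthogonal to `B` and `JB`, only the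
  -- term `g(W,W) B` of the conformal formula survives.
  have h3 : (1 / 2 * g.inner (i p) (W (i p)) (W (i p))) • J 0 (i p) (B (i p))
      = ∑ b, k b • J b (i p) (W (i p)) - ∑ b, l b • J b (i p) (W (i p)) := by
    rw [← hk, ← hl]
    simp only [h1, h2, hwB, map_sub, map_add, map_smul]
    module
  have orth (b) : g.inner (i p) (J b (i p) (W (i p))) (J 0 (i p) (B (i p))) = 0 := by
    rw [hT.skew]
    fin_cases b
    · simp [hT.sq, hwB]
    · simp [hT.mul_one_zero, hwJ]
    · simp [hT.mul_two_zero, hwJ]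
  have h4 := congrArg (fun t ↦ g.inner (i p) t (J 0 (i p) (B (i p)))) h3
  simp [orth, hT.isometric] at h4
  rcases h4 with h4 | h4
  · exact (g.pos (i p) _ hw0).ne' h4
  · exact (g.pos (i p) _ hB0).ne' h4

lemma inner_normalize {w : TangentSpace 𝓘(ℝ, E) x} (hw : w ≠ 0) :
    g.inner x ((√(g.inner x w w))⁻¹ • w) ((√(g.inner x w w))⁻¹ • w) = 1 := by
  have h := g.pos x w hw
  simp only [map_smul, smul_apply, smul_eq_mul]
  rw [← mul_assoc, ← mul_inv, Real.mul_self_sqrt h.le, inv_mul_cancel₀ h.ne']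

/-- The sectional curvatures of the planes spanned by a vector of `D` and one of `D'` are not all
equal to `1 / 4`. -/
lemma exists_sectionalCurvature_ne [FiniteDimensional ℝ E] (hN : IsLCQK g.inner H θ)
    (hB : ∀ (x : N) (v : TangentSpace 𝓘(ℝ, E) x), θ x v = g.inner x v (B x))
    (hn : IsLeviCivitaOn g.inner nabla univ) (hparallel : IsParallelForm nabla θ)
    (hunit : ∀ x : N, g.inner x (B x) (B x) = 1)
    (hi : Manifold.IsImmersion 𝓘(ℝ, F) 𝓘(ℝ, E) ∞ i)
    (hM : IsQuaternionCR g.inner H i D D')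
    (humb : IsTotallyUmbilical (F := F) g.inner nabla i)
    (hD : D p ≠ ⊥) (hD' : D' p ≠ ⊥)
    (htan : B (i p) ∈ tangentRange (F := F) i p) :
    ∃ X ∈ D p, ∃ Y ∈ D' p, IsOrthonormalPair g.inner i p X Y ∧
      sectionalCurvature g.inner nabla (i p) (mfderiv 𝓘(ℝ, F) 𝓘(ℝ, E) i p X)
        (mfderiv 𝓘(ℝ, F) 𝓘(ℝ, E) i p Y) ≠ 1 / 4 := by
  obtain ⟨B₀, hB₀⟩ := mem_tangentRange.1 htan
  obtain ⟨X, hX, Y, hY, rfl⟩ := Submodule.mem_sup.1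
    ((hM.complementary p).sup_eq_top ▸ Submodule.mem_top : B₀ ∈ D p ⊔ D' p)
  have o {X Y} (hX : X ∈ D p) (hY : Y ∈ D' p) := hM.orthogonal p X hX Y hY
  -- After normalization, a pair not entirely orthogonal to `B` makes one of the subtracted squares
  -- in `sectionalCurvature_eq` positive.
  have key {X' Y'} (hX' : X' ∈ D p) (hY' : Y' ∈ D' p) (hX0 : X' ≠ 0) (hY0 : Y' ≠ 0)
      (h : g.inner (i p) (mfderiv 𝓘(ℝ, F) 𝓘(ℝ, E) i p X') (B (i p)) ≠ 0 ∨
        g.inner (i p) (mfderiv 𝓘(ℝ, F) 𝓘(ℝ, E) i p Y') (B (i p)) ≠ 0) :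
      ∃ X ∈ D p, ∃ Y ∈ D' p, IsOrthonormalPair g.inner i p X Y ∧
        sectionalCurvature g.inner nabla (i p) (mfderiv 𝓘(ℝ, F) 𝓘(ℝ, E) i p X)
          (mfderiv 𝓘(ℝ, F) 𝓘(ℝ, E) i p Y) ≠ 1 / 4 := by
    have hu := mfderiv_ne_zero_of_isImmersion hi hX0
    have hv := mfderiv_ne_zero_of_isImmersion hi hY0
    have ru := inv_pos.2 (Real.sqrt_pos.2 (g.pos _ _ hu))
    have rv := inv_pos.2 (Real.sqrt_pos.2 (g.pos _ _ hv))
    have hXn := Submodule.smul_mem _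
      (√(g.inner (i p) (mfderiv 𝓘(ℝ, F) 𝓘(ℝ, E) i p X') (mfderiv 𝓘(ℝ, F) 𝓘(ℝ, E) i p X')))⁻¹ hX'
    have hYn := Submodule.smul_mem _
      (√(g.inner (i p) (mfderiv 𝓘(ℝ, F) 𝓘(ℝ, E) i p Y') (mfderiv 𝓘(ℝ, F) 𝓘(ℝ, E) i p Y')))⁻¹ hY'
    have hp : IsOrthonormalPair g.inner i p _ _ :=
      ⟨by rw [map_smul]; exact inner_normalize hu, by rw [map_smul]; exact inner_normalize hv,
        o hXn hYn⟩
    refine ⟨_, hXn, _, hYn, hp, ?_⟩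
    rw [sectionalCurvature_eq hN hB hn hparallel hunit hi hM humb htan hXn hYn hp]
    simp only [map_smul, smul_apply, smul_eq_mul, mul_pow]
    rcases h with h | h
    · have h1 := mul_pos (pow_pos ru 2) (pow_pos (abs_pos.2 h) 2)
      rw [sq_abs] at h1
      intro h2
      nlinarith [mul_nonneg (sq_nonneg (√(g.inner (i p) (mfderiv 𝓘(ℝ, F) 𝓘(ℝ, E) i p Y')
        (mfderiv 𝓘(ℝ, F) 𝓘(ℝ, E) i p Y')))⁻¹) (sq_nonneg
          (g.inner (i p) (mfderiv 𝓘(ℝ, F) 𝓘(ℝ, E) i p Y') (B (i p))))]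
    · have h1 := mul_pos (pow_pos rv 2) (pow_pos (abs_pos.2 h) 2)
      rw [sq_abs] at h1
      intro h2
      nlinarith [mul_nonneg (sq_nonneg (√(g.inner (i p) (mfderiv 𝓘(ℝ, F) 𝓘(ℝ, E) i p X')
        (mfderiv 𝓘(ℝ, F) 𝓘(ℝ, E) i p X')))⁻¹) (sq_nonneg
          (g.inner (i p) (mfderiv 𝓘(ℝ, F) 𝓘(ℝ, E) i p X') (B (i p))))]
  -- A nonzero component of `B` in one distribution is not orthogonal to `B`; properness provides
  -- its partner in the other.
  by_cases hX0 : X = 0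
  · have hY0 : Y ≠ 0 := by
      rintro rfl
      have := hunit (i p)
      rw [← hB₀, hX0] at this
      simp at this
    obtain ⟨W, hW, hW0⟩ := (Submodule.ne_bot_iff _).1 hD
    refine key hW hY hW0 hY0 (Or.inr ?_)
    rw [← hB₀, hX0, zero_add]
    exact (g.pos _ _ (mfderiv_ne_zero_of_isImmersion hi hY0)).ne'
  · obtain ⟨W, hW, hW0⟩ := (Submodule.ne_bot_iff _).1 hD'
    refine key hX hW hX0 hW0 (Or.inl ?_)
    rw [← hB₀, map_add, map_add, o hX hY, add_zero]
    exact (g.pos _ _ (mfderiv_ne_zero_of_isImmersion hi hX0)).ne'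

end Main

end QCR

end

theorem theorem4p1
    {E : Type*} [NormedAddCommGroup E] [NormedSpace ℝ E] [FiniteDimensional ℝ E]
    {N : Type*} [TopologicalSpace N] [ChartedSpace E N] [IsManifold 𝓘(ℝ, E) ∞ N]
    [T2Space N] [CompactSpace N]
    {F : Type*} [NormedAddCommGroup F] [NormedSpace ℝ F] [FiniteDimensional ℝ F]
    {M : Type*} [TopologicalSpace M] [ChartedSpace F M] [IsManifold 𝓘(ℝ, F) ∞ M]
    [T2Space M] [Nonempty M]
    -- the compact l.c.q.K. manifold `N`, its Lee form, Lee field and Levi-Civita connection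
    (g : ContMDiffRiemannianMetric 𝓘(ℝ, E) ∞ E (fun x : N ↦ TangentSpace 𝓘(ℝ, E) x))
    (H : Π x : N, Submodule ℝ (TangentSpace 𝓘(ℝ, E) x →L[ℝ] TangentSpace 𝓘(ℝ, E) x))
    (θ : Π x : N, TangentSpace 𝓘(ℝ, E) x →L[ℝ] ℝ)
    (hN : QCR.IsLCQK g.inner H θ)
    (B : Π x : N, TangentSpace 𝓘(ℝ, E) x)
    (hB : ∀ (x : N) (v : TangentSpace 𝓘(ℝ, E) x), θ x v = g.inner x v (B x))
    (nabla : (Π x : N, TangentSpace 𝓘(ℝ, E) x) →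
      (Π x : N, TangentSpace 𝓘(ℝ, E) x →L[ℝ] TangentSpace 𝓘(ℝ, E) x))
    (hnabla : QCR.IsLeviCivitaOn g.inner nabla univ)
    -- the Lee form is parallel of unit length
    (hparallel : QCR.IsParallelForm nabla θ)
    (hunit : ∀ x : N, g.inner x (B x) (B x) = 1)
    -- the totally umbilical quaternion CR-submanifold `M`, tangent to the Lee field
    (i : M → N) (hi : Manifold.IsImmersion 𝓘(ℝ, F) 𝓘(ℝ, E) ∞ i)
    (D D' : Π p : M, Submodule ℝ (TangentSpace 𝓘(ℝ, F) p))
    (hM : QCR.IsQuaternionCR g.inner H i D D')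
    (humb : QCR.IsTotallyUmbilical (F := F) g.inner nabla i)
    (htan : ∀ p : M, ∃ w : TangentSpace 𝓘(ℝ, F) p,
      B (i p) = mfderiv 𝓘(ℝ, F) 𝓘(ℝ, E) i p w) :
    (∀ p, ∀ X ∈ D p, ∀ Y ∈ D' p, QCR.IsOrthonormalPair g.inner i p X Y →
      QCR.sectionalCurvature g.inner nabla (i p)
        (mfderiv 𝓘(ℝ, F) 𝓘(ℝ, E) i p X) (mfderiv 𝓘(ℝ, F) 𝓘(ℝ, E) i p Y) ≤ 1 / 4) ∧
    (QCR.IsProper D D' →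
      ((∀ p, ∀ X ∈ D p, ∀ Y ∈ D' p, QCR.IsOrthonormalPair g.inner i p X Y →
        QCR.sectionalCurvature g.inner nabla (i p)
          (mfderiv 𝓘(ℝ, F) 𝓘(ℝ, E) i p X) (mfderiv 𝓘(ℝ, F) 𝓘(ℝ, E) i p Y) = 1 / 4) ↔
        QCR.IsQuaternionKaehlerOn g.inner H univ) ∧
      (QCR.IsQuaternionKaehlerOn g.inner H univ ↔ ∀ x : N, B x = 0)) := by
  have htan' (p : M) : B (i p) ∈ QCR.tangentRange (F := F) i p :=
    let ⟨w, h⟩ := htan p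
    ⟨w, h.symm⟩
  refine ⟨fun p X hX Y hY h ↦ ?_, fun hprop ↦ ?_⟩
  · rw [QCR.sectionalCurvature_eq hN hB hnabla hparallel hunit hi hM humb (htan' p) hX hY h]
    linarith [sq_nonneg (g.inner (i p) (mfderiv 𝓘(ℝ, F) 𝓘(ℝ, E) i p X) (B (i p))),
      sq_nonneg (g.inner (i p) (mfderiv 𝓘(ℝ, F) 𝓘(ℝ, E) i p Y) (B (i p)))]
  obtain ⟨p⟩ := ‹Nonempty M›
  obtain ⟨hD, hD'⟩ := hprop p
  have hB0 : B (i p) ≠ 0 := by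
    intro h0
    have := hunit (i p)
    rw [h0] at this
    simp at this
  have hK := QCR.not_isQuaternionKaehlerOn hN hB hnabla hi hM hD hD' (htan' p) hB0
  obtain ⟨X, hX, Y, hY, h, hne⟩ := QCR.exists_sectionalCurvature_ne hN hB hnabla hparallel hunit
    hi hM humb hD hD' (htan' p)
  -- Both equivalences hold because each of the three statements fails, already by what happens at
  -- the point `p`.
  exact ⟨iff_of_false (fun h4 ↦ hne (h4 p X hX Y hY h)) hK, iff_of_false hK fun h ↦ hB0 (h _)⟩
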